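/- Let $a_1,\dots,a_d$ be a basis of $\mathbb R^d$ and let $\Gamma=\mathbb Z a_1+\dots+\mathbb Z a_d$. Let $\mathcal G$ be a connected infinite graph, possibly with loops and multiple edges, with vertex set $\mathcal V\subset\mathbb R^d$, which is $\Gamma$-periodic: $\Gamma$ acts on $\mathcal G$, by translations on $\mathcal V$, and the quotient graph $\mathcal G/\Gamma$ is finite. Let $\mathcal A$ be the set of oriented edges of $\mathcal G$; each unoriented edge (loops included) gives two oriented edges $\mathbf e$ and $\underline{\mathbf e}$, inverse to each other. Let $\alpha:\mathcal A\to\mathbb R$ be a periodic magnetic potential, i.e. $\alpha(\underline{\mathbf e})=-\alpha(\mathbf e)$ and $\alpha(\mathbf e+\gamma)=\alpha(\mathbf e)$ for all $\mathbf e\in\mathcal A$, $\gamma\in\Gamma$, and let $Q:\mathcal V\to\mathbb R$ be a periodic electric potential, i.e. $Q(v+\gamma)=Q(v)$ for all $v\in\mathcal V$, $\gamma\in\Gamma$. For $t\in\mathbb R$ let $H_{t\alpha}=\Delta_{t\alpha}+Q$ be the bounded self-adjoint operator on $\ell^2(\mathcal V)$ given by $$(H_{t\alpha}f)(v)=\sum_{\mathbf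 e=(v,u)\in\mathcal A}\bigl(f(v)-e^{it\alpha(\mathbf e)}f(u)\bigr)+Q(v)f(v),\qquad v\in\mathcal V,$$ where the sum is over all oriented edges starting at $v$. Then for all except finitely many $t\in[0,1]$ the absolutely continuous spectrum of $H_{t\alpha}$ is not empty. (The absolutely continuous spectrum of a bounded self-adjoint operator $T$ is the spectrum of the restriction of $T$ to the closed subspace of the vectors whose spectral measure is absolutely continuous with respect to Lebesgue measure.) -/

import Mathlib

open MeasureTheory

noncomputable section

/-! ### Periodic graphs -/

/-- The lattice `Γ = {∑ nₛ aₛ : nₛ ∈ ℤ}` of rank `d` in `ℝ^d` with basis `a₁, …, a_d`. -/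
abbrev periodLattice {d : ℕ} (a : Module.Basis (Fin d) ℝ (EuclideanSpace ℝ (Fin d))) :
    Submodule ℤ (EuclideanSpace ℝ (Fin d)) :=
  Submodule.span ℤ (Set.range a)

/-- A connected infinite graph with vertex set `V` embedded into `ℝ^d` and set `A` of oriented
edges, loops and multiple edges being allowed, which is periodic with respect to the lattice with
basis `a` and has a finite quotient graph.  Every unoriented edge (also a loop) appears in `A` with
its two orientations `e` and `rev e`. -/
structure PeriodicGraph {d : ℕ} (a : Module.Basis (Fin d) ℝ (EuclideanSpace ℝ (Fin d)))
    (V A : Type*) [AddAction (periodLattice a) V] [AddAction (periodLattice a) A] where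
  /-- the position of a vertex in `ℝ^d` -/
  pos : V → EuclideanSpace ℝ (Fin d)
  pos_injective : Function.Injective pos
  /-- the lattice acts on the vertices by translations -/
  pos_vadd : ∀ (γ : periodLattice a) (v : V), pos (γ +ᵥ v) = pos v + γ
  /-- the vertex at which an oriented edge starts -/
  src : A → V
  /-- the vertex at which an oriented edge ends -/
  tgt : A → V
  /-- the inverse edge -/
  rev : A → A
  rev_rev : ∀ e, rev (rev e) = e
  rev_ne : ∀ e, rev e ≠ e
  src_rev : ∀ e, src (rev e) = tgt e
  src_vadd : ∀ (γ : periodLattice a) (e : A), src (γ +ᵥ e) = γ +ᵥ src e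
  tgt_vadd : ∀ (γ : periodLattice a) (e : A), tgt (γ +ᵥ e) = γ +ᵥ tgt e
  rev_vadd : ∀ (γ : periodLattice a) (e : A), rev (γ +ᵥ e) = γ +ᵥ rev e
  infinite : Infinite V
  connected : ∀ u v : V, Relation.ReflTransGen (fun x y => ∃ e, src e = x ∧ tgt e = y) u v
  /-- the quotient graph has finitely many vertices -/
  finite_vertices : Finite (AddAction.orbitRel.Quotient (periodLattice a) V)
  /-- the quotient graph has finitely many edges -/
  finite_edges : Finite (AddAction.orbitRel.Quotient (periodLattice a) A)

/-- The Hilbert space `ℓ²(V)` of square summable functions `V → ℂ`. -/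
abbrev ell2 (V : Type*) := lp (fun _ : V => ℂ) 2

namespace PeriodicGraph

variable {d : ℕ} {a : Module.Basis (Fin d) ℝ (EuclideanSpace ℝ (Fin d))} {V A : Type*}
  [AddAction (periodLattice a) V] [AddAction (periodLattice a) A]

/-- A periodic magnetic vector potential: a real function on the oriented edges, odd under
reversal of the edges and invariant under the lattice. -/
@[ext]
structure MagneticPotential (G : PeriodicGraph a V A) where
  toFun : A → ℝ
  map_rev : ∀ e, toFun (G.rev e) = -toFun e
  periodic : ∀ (γ : periodLattice a) (e : A), toFun (γ +ᵥ e) = toFun e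

/-- A periodic electric potential: a real function on the vertices, invariant under the lattice. -/
@[ext]
structure ElectricPotential (_G : PeriodicGraph a V A) where
  toFun : V → ℝ
  periodic : ∀ (γ : periodLattice a) (v : V), toFun (γ +ᵥ v) = toFun v

/-- The magnetic potential `t α` with coupling constant `t`. -/
instance (G : PeriodicGraph a V A) : SMul ℝ G.MagneticPotential where
  smul t α :=
    { toFun := fun e => t * α.toFun e
      map_rev := fun e => by rw [α.map_rev]; ring
      periodic := fun γ e => by rw [α.periodic] }

/-- The oriented edges starting at the vertex `v`. -/
abbrev EdgesAt (G : PeriodicGraph a V A) (v : V) := {e : A // G.src e = v}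

lemma edgesAt_injective (G : PeriodicGraph a V A) (v : V) :
    Function.Injective (fun e : G.EdgesAt v =>
      (Quotient.mk _ e.1 : AddAction.orbitRel.Quotient (periodLattice a) A)) := by
  rintro ⟨e, he⟩ ⟨e', he'⟩ h
  obtain ⟨γ, hγ⟩ : ∃ γ : periodLattice a, γ +ᵥ e' = e := Quotient.exact h
  have h1 : G.pos v = G.pos v + γ := by
    conv_lhs => rw [← he, ← hγ, G.src_vadd, he', G.pos_vadd]
  have h2 : γ = 0 := by
    apply Subtype.ext
    simpa using h1
  subst h2
  simpa using hγ.symm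

instance (G : PeriodicGraph a V A) (v : V) : Finite (G.EdgesAt v) :=
  have := G.finite_edges
  Finite.of_injective _ (G.edgesAt_injective v)

instance (G : PeriodicGraph a V A) (v : V) : Fintype (G.EdgesAt v) := Fintype.ofFinite _

/-- The expression
`(Δ_α f)(v) + Q(v) f(v)`, where `(Δ_α f)(v) = ∑_{e = (v, u)} (f(v) - exp(i α(e)) f(u))`. -/
def schrodingerFun (G : PeriodicGraph a V A) (α : G.MagneticPotential) (Q : G.ElectricPotential)
    (f : V → ℂ) (v : V) : ℂ :=
  ∑ e : G.EdgesAt v, (f v - Complex.exp (Complex.I * α.toFun e) * f (G.tgt e)) + Q.toFun v * f v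

/-- The number of edges of the quotient graph, which bounds the degrees of the vertices. -/
def edgeCount (_G : PeriodicGraph a V A) : ℕ :=
  Nat.card (AddAction.orbitRel.Quotient (periodLattice a) A)

lemma card_edgesAt_le (G : PeriodicGraph a V A) (v : V) :
    Fintype.card (G.EdgesAt v) ≤ G.edgeCount := by
  have := G.finite_edges
  rw [← Nat.card_eq_fintype_card]
  exact Nat.card_le_card_of_injective _ (G.edgesAt_injective v)

lemma exists_bound (G : PeriodicGraph a V A) (Q : G.ElectricPotential) :
    ∃ C : ℝ, 0 ≤ C ∧ ∀ v, |Q.toFun v| ≤ C := by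
  have := G.finite_vertices
  let q : AddAction.orbitRel.Quotient (periodLattice a) V → ℝ :=
    Quotient.lift (fun v => |Q.toFun v|) (by
      rintro v w ⟨γ, rfl⟩
      simp [Q.periodic])
  obtain ⟨C, hC⟩ := (Set.finite_range q).bddAbove
  refine ⟨max C 0, le_max_right _ _, fun v => le_max_of_le_left ?_⟩
  exact hC ⟨Quotient.mk _ v, rfl⟩

/-- Reversal of the edges. -/
def revEquiv (G : PeriodicGraph a V A) : A ≃ A := ⟨G.rev, G.rev, G.rev_rev, G.rev_rev⟩

lemma tgt_rev (G : PeriodicGraph a V A) (e : A) : G.tgt (G.rev e) = G.src e := by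
  rw [← G.src_rev, G.rev_rev]

lemma summable_edges {𝕜 : Type*} [NormedAddCommGroup 𝕜] [CompleteSpace 𝕜]
    (G : PeriodicGraph a V A) {g : A → 𝕜} (hg : Summable g) :
    Summable (fun v => ∑ e : G.EdgesAt v, g e) ∧
      ∑' v, ∑ e : G.EdgesAt v, g e = ∑' e, g e := by
  have h1 : Summable (fun x : (Σ v, G.EdgesAt v) => g x.2.1) :=
    (Equiv.sigmaFiberEquiv G.src).summable_iff.mpr hg
  have h2 := h1.sigma
  have h3 := h1.tsum_sigma
  simp only [tsum_fintype] at h2 h3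
  exact ⟨h2, by rw [← h3]; exact (Equiv.sigmaFiberEquiv G.src).tsum_eq g⟩

lemma summable_src (G : PeriodicGraph a V A) {c : V → ℝ} (h0 : ∀ v, 0 ≤ c v) (hc : Summable c) :
    Summable (fun e => c (G.src e)) ∧ ∑' e, c (G.src e) ≤ G.edgeCount * ∑' v, c v := by
  have key : ∀ v, ∑' e : G.EdgesAt v, c (G.src e) = Fintype.card (G.EdgesAt v) * c v := by
    intro v
    rw [tsum_fintype, Finset.sum_congr rfl (fun e _ => by rw [e.2])]
    simp
  have hle : ∀ v, (Fintype.card (G.EdgesAt v) : ℝ) * c v ≤ G.edgeCount * c v := fun v =>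
    mul_le_mul_of_nonneg_right (by exact_mod_cast G.card_edgesAt_le v) (h0 v)
  have hs : Summable (fun v => (Fintype.card (G.EdgesAt v) : ℝ) * c v) :=
    Summable.of_nonneg_of_le (fun v => mul_nonneg (by positivity) (h0 v)) hle (hc.mul_left _)
  have h1 : Summable (fun x : (Σ v, G.EdgesAt v) => c (G.src x.2.1)) := by
    rw [summable_sigma_of_nonneg (fun x => h0 _)]
    exact ⟨fun v => Summable.of_finite, by simpa only [key] using hs⟩
  have h2 : Summable (fun e => c (G.src e)) :=
    (Equiv.sigmaFiberEquiv G.src).summable_iff.mp h1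
  refine ⟨h2, ?_⟩
  rw [← (G.summable_edges h2).2, ← tsum_mul_left]
  simp only [tsum_fintype] at key
  refine Summable.tsum_le_tsum (fun v => (key v).trans_le (hle v)) ?_ (hc.mul_left _)
  exact (summable_congr key).mpr hs

lemma summable_tgt (G : PeriodicGraph a V A) {c : V → ℝ} (h0 : ∀ v, 0 ≤ c v) (hc : Summable c) :
    Summable (fun e => c (G.tgt e)) ∧ ∑' e, c (G.tgt e) ≤ G.edgeCount * ∑' v, c v := by
  have h := G.summable_src h0 hc
  rw [← G.revEquiv.summable_iff, ← G.revEquiv.tsum_eq] at h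
  simpa [revEquiv, Function.comp_def, G.src_rev] using h

lemma summable_sq {V : Type*} (f : ell2 V) : Summable (fun v => ‖f v‖ ^ 2) := by
  simpa using (lp.memℓp f).summable (by norm_num)

lemma norm_sq_eq {V : Type*} (f : ell2 V) : ‖f‖ ^ 2 = ∑' v, ‖f v‖ ^ 2 := by
  simpa using lp.norm_rpow_eq_tsum (p := 2) (by norm_num) f

/-- Boundedness of the Schrödinger operator on `ℓ²(V)`. -/
lemma schrodingerFun_bound (G : PeriodicGraph a V A) (α : G.MagneticPotential)
    (Q : G.ElectricPotential) : ∃ C : ℝ, 0 ≤ C ∧ ∀ f : ell2 V,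
      Summable (fun v => ‖G.schrodingerFun α Q f v‖ ^ 2) ∧
        ∑' v, ‖G.schrodingerFun α Q f v‖ ^ 2 ≤ C ^ 2 * ‖f‖ ^ 2 := by
  obtain ⟨q, hq0, hq⟩ := G.exists_bound Q
  set N : ℝ := (G.edgeCount : ℝ)
  have hN0 : 0 ≤ N := by positivity
  set K : ℝ := 2 * (N + q) ^ 2 + 2 * N * N
  have hK : 0 ≤ K := by positivity
  refine ⟨Real.sqrt K, Real.sqrt_nonneg _, fun f => ?_⟩
  rw [Real.sq_sqrt hK, norm_sq_eq]
  set c : V → ℝ := fun v => ‖f v‖ ^ 2 with hc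
  have h0 : ∀ v, 0 ≤ c v := fun v => by positivity
  have hcs : Summable c := summable_sq f
  obtain ⟨ht1, ht2⟩ := G.summable_tgt h0 hcs
  obtain ⟨hs2, hs3⟩ := G.summable_edges ht1
  rw [← hs3] at ht2
  have hcard : ∀ v, (Fintype.card (G.EdgesAt v) : ℝ) ≤ N := fun v =>
    Nat.cast_le.mpr (G.card_edgesAt_le v)
  have hpt : ∀ v, ‖G.schrodingerFun α Q f v‖ ^ 2 ≤
      2 * (N + q) ^ 2 * c v + 2 * N * ∑ e : G.EdgesAt v, c (G.tgt e) := by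
    intro v
    have e1 : ‖G.schrodingerFun α Q f v‖ ≤
        (N + q) * ‖f v‖ + ∑ e : G.EdgesAt v, ‖f (G.tgt e)‖ := by
      unfold schrodingerFun
      rw [Finset.sum_sub_distrib]
      have a1 : ‖∑ e : G.EdgesAt v, f v‖ ≤ N * ‖f v‖ := by
        simp only [Finset.sum_const, Finset.card_univ, nsmul_eq_mul, norm_mul,
          Complex.norm_natCast]
        exact mul_le_mul_of_nonneg_right (hcard v) (norm_nonneg _)
      have a2 : ‖∑ e : G.EdgesAt v, Complex.exp (Complex.I * α.toFun e) * f (G.tgt e)‖ ≤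
          ∑ e : G.EdgesAt v, ‖f (G.tgt e)‖ := by
        refine (norm_sum_le _ _).trans (Finset.sum_le_sum fun e _ => ?_)
        rw [norm_mul, Complex.norm_exp_I_mul_ofReal, one_mul]
      have a3 : ‖(Q.toFun v : ℂ) * f v‖ ≤ q * ‖f v‖ := by
        rw [norm_mul, Complex.norm_real]
        exact mul_le_mul_of_nonneg_right (hq v) (norm_nonneg _)
      refine (norm_add_le _ _).trans ?_
      have := norm_sub_le (∑ e : G.EdgesAt v, f v)
        (∑ e : G.EdgesAt v, Complex.exp (Complex.I * α.toFun e) * f (G.tgt e))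
      linarith
    have e2 : (∑ e : G.EdgesAt v, ‖f (G.tgt e)‖) ^ 2 ≤ N * ∑ e : G.EdgesAt v, c (G.tgt e) := by
      refine (sq_sum_le_card_mul_sum_sq (s := Finset.univ)).trans ?_
      rw [Finset.card_univ]
      exact mul_le_mul_of_nonneg_right (hcard v) (Finset.sum_nonneg fun e _ => h0 _)
    have e3 := pow_le_pow_left₀ (norm_nonneg _) e1 2
    have e4 := add_sq_le (a := (N + q) * ‖f v‖) (b := ∑ e : G.EdgesAt v, ‖f (G.tgt e)‖)
    have e5 : ((N + q) * ‖f v‖) ^ 2 = (N + q) ^ 2 * c v := by rw [mul_pow]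
    nlinarith
  have hS : Summable (fun v => 2 * (N + q) ^ 2 * c v +
      2 * N * ∑ e : G.EdgesAt v, c (G.tgt e)) := (hcs.mul_left _).add (hs2.mul_left _)
  have hsum := Summable.of_nonneg_of_le (fun v => by positivity) hpt hS
  refine ⟨hsum, (hsum.tsum_le_tsum hpt hS).trans ?_⟩
  rw [(hcs.mul_left _).tsum_add (hs2.mul_left _), tsum_mul_left, tsum_mul_left]
  have := mul_le_mul_of_nonneg_left ht2 (show 0 ≤ 2 * N by positivity)
  simp only [K]
  linarith

lemma memℓp_schrodingerFun (G : PeriodicGraph a V A) (α : G.MagneticPotential)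
    (Q : G.ElectricPotential) (f : ell2 V) : Memℓp (G.schrodingerFun α Q f) 2 := by
  obtain ⟨C, -, h⟩ := G.schrodingerFun_bound α Q
  exact memℓp_gen (by simpa using (h f).1)

/-- The magnetic Schrödinger operator `H_α = Δ_α + Q` as a linear operator on `ℓ²(V)`. -/
def schrodingerLin (G : PeriodicGraph a V A) (α : G.MagneticPotential)
    (Q : G.ElectricPotential) : ell2 V →ₗ[ℂ] ell2 V where
  toFun f := ⟨G.schrodingerFun α Q f, G.memℓp_schrodingerFun α Q f⟩
  map_add' f g := by
    ext v
    simp only [schrodingerFun, lp.coeFn_add, Pi.add_apply]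
    simp only [mul_add, Finset.sum_sub_distrib, Finset.sum_add_distrib]
    ring
  map_smul' z f := by
    ext v
    simp only [schrodingerFun, lp.coeFn_smul, Pi.smul_apply, smul_eq_mul, RingHom.id_apply,
      mul_add, Finset.mul_sum]
    congr 1
    · exact Finset.sum_congr rfl fun e _ => by ring
    · ring

/-- The magnetic Schrödinger operator `H_α = Δ_α + Q` as a bounded operator on `ℓ²(V)`. -/
def schrodingerCLM (G : PeriodicGraph a V A) (α : G.MagneticPotential)
    (Q : G.ElectricPotential) : ell2 V →L[ℂ] ell2 V where
  toLinearMap := G.schrodingerLin α Q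
  cont := by
    obtain ⟨C, hC, h⟩ := G.schrodingerFun_bound α Q
    refine (G.schrodingerLin α Q).mkContinuous C (fun f => ?_) |>.continuous
    refine le_of_sq_le_sq ?_ (by positivity)
    rw [mul_pow, norm_sq_eq]
    exact (h f).2

lemma schrodingerCLM_apply (G : PeriodicGraph a V A) (α : G.MagneticPotential)
    (Q : G.ElectricPotential) (f : ell2 V) (v : V) :
    G.schrodingerCLM α Q f v = G.schrodingerFun α Q f v := rfl

lemma isSelfAdjoint_schrodingerCLM (G : PeriodicGraph a V A) (α : G.MagneticPotential)
    (Q : G.ElectricPotential) : IsSelfAdjoint (G.schrodingerCLM α Q) := by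
  rw [ContinuousLinearMap.isSelfAdjoint_iff_isSymmetric]
  intro f g
  set h : A → ℂ := fun e =>
    (starRingEnd ℂ) (f (G.src e)) * (Complex.exp (Complex.I * α.toFun e) * g (G.tgt e)) with hh
  set k : A → ℂ := fun e =>
    (starRingEnd ℂ) (Complex.exp (Complex.I * α.toFun e) * f (G.tgt e)) * g (G.src e) with hk
  have hrev : ∀ e, k (G.rev e) = h e := by
    intro e
    simp only [hh, hk, G.tgt_rev, G.src_rev, α.map_rev, map_mul, ← Complex.exp_conj,
      Complex.conj_I, Complex.conj_ofReal, Complex.ofReal_neg, neg_mul_neg]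
    ring
  have hsum : Summable h := by
    have h1 := (G.summable_src (fun v => by positivity) (summable_sq f)).1
    have h2 := (G.summable_tgt (fun v => by positivity) (summable_sq g)).1
    refine Summable.of_norm_bounded (h1.add h2) fun e => ?_
    simp only [hh, norm_mul, RCLike.norm_conj, Complex.norm_exp_I_mul_ofReal, one_mul]
    nlinarith [sq_nonneg (‖f (G.src e)‖ - ‖g (G.tgt e)‖), sq_nonneg ‖f (G.src e)‖,
      sq_nonneg ‖g (G.tgt e)‖]
  have hkeq : k ∘ G.revEquiv = h := funext hrev
  have ksum : Summable k := by rwa [← G.revEquiv.summable_iff, hkeq]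
  have htsum : ∑' e, k e = ∑' e, h e := by
    rw [← G.revEquiv.tsum_eq k]
    exact tsum_congr hrev
  obtain ⟨a1, a2⟩ := G.summable_edges hsum
  obtain ⟨b1, b2⟩ := G.summable_edges ksum
  rw [← sub_eq_zero]
  change inner ℂ (G.schrodingerCLM α Q f) g - inner ℂ f (G.schrodingerCLM α Q g) = 0
  rw [lp.inner_eq_tsum, lp.inner_eq_tsum,
    ← (lp.summable_inner (𝕜 := ℂ) _ g).tsum_sub (lp.summable_inner (𝕜 := ℂ) f _)]
  rw [← sub_eq_zero.mpr (a2.trans (htsum.symm.trans b2.symm)), ← a1.tsum_sub b1]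
  refine tsum_congr fun v => ?_
  have e1 : ∑ e : G.EdgesAt v, h e = (starRingEnd ℂ) (f v) *
      ∑ e : G.EdgesAt v, Complex.exp (Complex.I * α.toFun e) * g (G.tgt e) := by
    rw [Finset.mul_sum]
    exact Finset.sum_congr rfl fun e _ => by simp only [hh, e.2]
  have e2 : ∑ e : G.EdgesAt v, k e = (starRingEnd ℂ)
      (∑ e : G.EdgesAt v, Complex.exp (Complex.I * α.toFun e) * f (G.tgt e)) * g v := by
    rw [map_sum, Finset.sum_mul]
    exact Finset.sum_congr rfl fun e _ => by simp only [hk, e.2]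
  rw [e1, e2, schrodingerCLM_apply, schrodingerCLM_apply]
  simp only [schrodingerFun, RCLike.inner_apply, Finset.sum_sub_distrib, map_add, map_sub,
    Finset.sum_const, nsmul_eq_mul, map_mul, map_natCast, Complex.conj_ofReal]
  ring

/-- The magnetic Schrödinger operator `H_α = Δ_α + Q`, a bounded self-adjoint operator on
`ℓ²(V)`. -/
def schrodinger (G : PeriodicGraph a V A) (α : G.MagneticPotential)
    (Q : G.ElectricPotential) : selfAdjoint (ell2 V →L[ℂ] ell2 V) :=
  ⟨G.schrodingerCLM α Q, G.isSelfAdjoint_schrodingerCLM α Q⟩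

end PeriodicGraph

/-! ### The absolutely continuous spectrum of a bounded self-adjoint operator -/

section ACSpectrum

variable {E : Type*} [NormedAddCommGroup E] [InnerProductSpace ℂ E] [CompleteSpace E]

/-- `μ` is the spectral measure of the bounded self-adjoint operator `T` at the vector `f`: the
(unique) finite compactly supported Borel measure on `ℝ` with `∫ p dμ = ⟨f, p(T) f⟩` for all
polynomials `p`. -/
structure IsSpectralMeasure (T : selfAdjoint (E →L[ℂ] E)) (f : E) (μ : Measure ℝ) : Prop where
  finite : IsFiniteMeasure μ
  compact_support : ∃ K : Set ℝ, IsCompact K ∧ μ Kᶜ = 0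
  moment : ∀ n : ℕ, ((∫ x, x ^ n ∂μ : ℝ) : ℂ) = inner ℂ f ((T.1 ^ n) f)

/-- The vectors whose spectral measure is absolutely continuous with respect to Lebesgue
measure. -/
def acVectors (T : selfAdjoint (E →L[ℂ] E)) : Set E :=
  {f | ∃ μ : Measure ℝ, IsSpectralMeasure T f μ ∧ μ ≪ volume}

/-- The absolutely continuous subspace of `T`.  (The set `acVectors T` is known to be a closed
subspace, so that taking the closed linear span adds nothing to it.) -/
def acSubspace (T : selfAdjoint (E →L[ℂ] E)) : Submodule ℂ E :=
  (Submodule.span ℂ (acVectors T)).topologicalClosure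

lemma acVectors_mapsTo (T : selfAdjoint (E →L[ℂ] E)) {f : E} (hf : f ∈ acVectors T) :
    T.1 f ∈ acVectors T := by
  obtain ⟨μ, hμ, hac⟩ := hf
  have := hμ.finite
  obtain ⟨K, hK, hKμ⟩ := hμ.compact_support
  have hmeas : Measurable (fun x : ℝ => Real.toNNReal (x ^ 2)) := by fun_prop
  have hint : Integrable (fun x : ℝ => x ^ 2) μ := by
    have h1 : IntegrableOn (fun x : ℝ => x ^ 2) K μ :=
      (by fun_prop : Continuous fun x : ℝ => x ^ 2).continuousOn.integrableOn_compact hK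
    rwa [IntegrableOn, Measure.restrict_eq_self_of_ae_mem] at h1
    exact hKμ
  have hwd : μ.withDensity (fun x => (Real.toNNReal (x ^ 2) : ENNReal)) ≪ μ :=
    withDensity_absolutelyContinuous _ _
  refine ⟨_, ⟨?_, ⟨K, hK, hwd hKμ⟩, fun n => ?_⟩, hwd.trans hac⟩
  · exact isFiniteMeasure_withDensity_ofReal hint.2
  · rw [integral_withDensity_eq_integral_smul hmeas]
    have h1 : ∀ x : ℝ, Real.toNNReal (x ^ 2) • x ^ n = x ^ (n + 2) := by
      intro x
      rw [NNReal.smul_def, Real.coe_toNNReal _ (sq_nonneg x), smul_eq_mul, ← pow_add, add_comm]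
    simp only [h1]
    have hsym := (ContinuousLinearMap.isSelfAdjoint_iff_isSymmetric.mp T.2)
    have h2 : inner ℂ (T.1 f) ((T.1 ^ n) (T.1 f)) = inner ℂ f (T.1 ((T.1 ^ n) (T.1 f))) :=
      hsym f _
    rw [hμ.moment, h2, pow_succ, pow_succ']
    rfl

lemma acSubspace_mapsTo (T : selfAdjoint (E →L[ℂ] E)) :
    ∀ f ∈ acSubspace T, T.1 f ∈ acSubspace T := by
  have h1 : ∀ f ∈ Submodule.span ℂ (acVectors T), T.1 f ∈ Submodule.span ℂ (acVectors T) := by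
    intro f hf
    have : Submodule.span ℂ (acVectors T) ≤
        (Submodule.span ℂ (acVectors T)).comap (T.1 : E →ₗ[ℂ] E) :=
      Submodule.span_le.mpr fun g hg => Submodule.subset_span (acVectors_mapsTo T hg)
    exact this hf
  intro f hf
  exact map_mem_closure T.1.continuous hf h1

/-- The restriction of `T` to its absolutely continuous subspace. -/
def acPart (T : selfAdjoint (E →L[ℂ] E)) : acSubspace T →L[ℂ] acSubspace T :=
  T.1.restrict (acSubspace_mapsTo T)

/-- The absolutely continuous spectrum of `T`: the spectrum of the restriction of `T` to its
absolutely continuous subspace. -/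
def acSpectrum (T : selfAdjoint (E →L[ℂ] E)) : Set ℂ :=
  spectrum ℂ (acPart T)

end ACSpectrum

end

/-! Floquet–Bloch theory replaces `H` by Hermitian matrices `H(k)`, with `k` in the torus, indexed
by the finitely many vertices of the quotient graph. Their ordered eigenvalues are the band
functions. Summing the spectral measures of the delta functions at one vertex per orbit gives the
sum of the distributions of the band functions under Haar measure: both have compact support, and
their `n`-th moments equal `∫ tr H(k)^n dk` (`sum_spectralMeasure_eq`).

If the absolutely continuous spectrum is empty, every spectral measure is singular, since a nonzero
absolutely continuous part would be the spectral measure of a nonzero vector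
(`mutuallySingular_volume`). Hence each band function has a singular distribution. Bands are
Lipschitz along lines of the torus, and a Lipschitz function of one variable with almost all values
in a null set is constant; with Fubini, every band is flat (`eq_of_mutuallySingular_map`). So `tr
H(k)^n` is independent of `k` for all `n`.

This fails at `t = 0`. The Fourier coefficient of `tr H(k)^n` at a lattice vector `γ ≠ 0` is the sum
over a fundamental domain of the kernel of `H^n` between `x` and `x + γ`. Flat bands make it vanish
for all `n`, hence also for `(C - H)^n`. But without phases and for large `C` the kernel of `C - H`
is nonnegative, and connectedness makes some power positive between a vertex and its translate.

Therefore, for some `n` and `k`, the difference of the traces at `k` and at `0` is a real-analytic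
function of `t` that is nonzero at `t = 0`. It has finitely many zeros in `[0,1]`, and every
exceptional `t` is one of them. -/

noncomputable section

/-! ### Spectral measures: existence, uniqueness from moments, polynomial approximation. -/

section SpectralMeasures

variable {E : Type*} [NormedAddCommGroup E] [InnerProductSpace ℂ E] [CompleteSpace E]

lemma ContinuousLinearMap.inner_eq_ofReal_re_of_isSelfAdjoint {S : E →L[ℂ] E}
    (hS : IsSelfAdjoint S) (f : E) : (((inner ℂ f (S f)).re : ℝ) : ℂ) = inner ℂ f (S f) := by
  rw [ContinuousLinearMap.isSelfAdjoint_iff_isSymmetric] at hS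
  have h : starRingEnd ℂ (inner ℂ f (S f)) = inner ℂ f (S f) := by
    rw [inner_conj_symm]
    exact hS f f
  exact Complex.conj_eq_iff_re.mp h

/-- The functional `g ↦ ⟨f, g(T) f⟩` on the continuous functions on the spectrum of `T`. -/
def spectralFunctional (T : E →L[ℂ] E) (hT : IsSelfAdjoint T) (f : E) :
    CompactlySupportedContinuousMap (spectrum ℝ T) ℝ →ₚ[ℝ] ℝ :=
  PositiveLinearMap.mk₀
    { toFun := fun g => (inner ℂ f (cfcHom (R := ℝ) hT (g : C(spectrum ℝ T, ℝ)) f)).re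
      map_add' := fun g h => by
        have : ((g + h : CompactlySupportedContinuousMap (spectrum ℝ T) ℝ) :
          C(spectrum ℝ T, ℝ)) = (g : C(spectrum ℝ T, ℝ)) + h := rfl
        simp [this]
      map_smul' := fun c g => by
        have : ((c • g : CompactlySupportedContinuousMap (spectrum ℝ T) ℝ) :
          C(spectrum ℝ T, ℝ)) = c • (g : C(spectrum ℝ T, ℝ)) := rfl
        simp [this] }
    (by
      intro g hg
      set G : C(spectrum ℝ T, ℝ) := (g : C(spectrum ℝ T, ℝ))
      -- Positivity: with `h` the square root of `G`, the functional at `G` is `‖h(T) f‖²`.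
      let h : C(spectrum ℝ T, ℝ) := ⟨fun x => Real.sqrt (G x), by fun_prop⟩
      have hG : G = h * h := by
        ext x
        exact (Real.mul_self_sqrt (hg x)).symm
      have hsa : IsSelfAdjoint (cfcHom (R := ℝ) hT h) :=
        (IsSelfAdjoint.all h).map _
      rw [ContinuousLinearMap.isSelfAdjoint_iff_isSymmetric] at hsa
      change 0 ≤ (inner ℂ f (cfcHom (R := ℝ) hT G f)).re
      rw [hG, map_mul]
      have h2 := hsa f (cfcHom (R := ℝ) hT h f)
      simp only [ContinuousLinearMap.coe_coe] at h2
      change 0 ≤ (inner ℂ f (cfcHom (R := ℝ) hT h (cfcHom (R := ℝ) hT h f))).re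
      rw [← h2]
      exact inner_self_nonneg (𝕜 := ℂ))

/-- Every vector has a spectral measure. -/
theorem exists_isSpectralMeasure (T : selfAdjoint (E →L[ℂ] E)) (f : E) :
    ∃ μ : Measure ℝ, IsSpectralMeasure T f μ := by
  have hT : IsSelfAdjoint T.1 := T.2
  have hcpt : CompactSpace (spectrum ℝ T.1) := isCompact_iff_compactSpace.mp (spectrum.isCompact _)
  set ν := RealRMK.rieszMeasure (spectralFunctional T.1 hT f)
  have hν : IsFiniteMeasure ν := ⟨(isCompact_univ.measure_lt_top)⟩
  refine ⟨ν.map Subtype.val, ?_, ⟨spectrum ℝ T.1, spectrum.isCompact _, ?_⟩, fun n => ?_⟩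
  · infer_instance
  · rw [Measure.map_apply measurable_subtype_coe (spectrum.isClosed _).measurableSet.compl]
    have : (Subtype.val ⁻¹' (spectrum ℝ T.1)ᶜ : Set (spectrum ℝ T.1)) = ∅ := by ext; simp
    simp [this]
  · rw [integral_map (by fun_prop) (by fun_prop)]
    let g : CompactlySupportedContinuousMap (spectrum ℝ T.1) ℝ :=
      CompactlySupportedContinuousMap.continuousMapEquiv
        ((ContinuousMap.restrict (spectrum ℝ T.1) (ContinuousMap.id ℝ)) ^ n)
    have h1 : ∫ x : spectrum ℝ T.1, (x : ℝ) ^ n ∂ν = ∫ x, g x ∂ν := rfl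
    rw [h1, RealRMK.integral_rieszMeasure]
    have h2 : spectralFunctional T.1 hT f g = (inner ℂ f ((T.1 ^ n) f)).re := by
      change (inner ℂ f (cfcHom (R := ℝ) hT
        ((ContinuousMap.restrict (spectrum ℝ T.1) (ContinuousMap.id ℝ)) ^ n) f)).re = _
      rw [map_pow, cfcHom_id]
    rw [h2]
    exact ContinuousLinearMap.inner_eq_ofReal_re_of_isSelfAdjoint (hT.pow n) f

lemma Polynomial.isSelfAdjoint_aeval_map_ofReal {T : E →L[ℂ] E} (hT : IsSelfAdjoint T)
    (p : Polynomial ℝ) : IsSelfAdjoint (Polynomial.aeval T (p.map Complex.ofRealHom)) := by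
  induction p using Polynomial.induction_on' with
  | add p q hp hq => simpa using hp.add hq
  | monomial n a =>
    rw [Polynomial.map_monomial, Polynomial.aeval_monomial, ← Algebra.smul_def]
    exact IsSelfAdjoint.smul (Complex.conj_ofReal a) (hT.pow n)

/-- A finite measure with compact support integrates continuous functions. -/
lemma Continuous.integrable_of_ae_mem_isCompact {μ : Measure ℝ} [IsFiniteMeasure μ] {K : Set ℝ}
    (hK : IsCompact K) (hμ : μ Kᶜ = 0) {g : ℝ → ℝ} (hg : Continuous g) : Integrable g μ := by
  have h1 : IntegrableOn g K μ := hg.continuousOn.integrableOn_compact hK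
  rwa [IntegrableOn, Measure.restrict_eq_self_of_ae_mem] at h1
  exact hμ

/-- Weierstrass approximation on a compact set of reals. -/
lemma IsCompact.exists_polynomial_near {K : Set ℝ} (hK : IsCompact K) {g : ℝ → ℝ}
    (hg : Continuous g) {δ : ℝ} (hδ : 0 < δ) :
    ∃ p : Polynomial ℝ, ∀ x ∈ K, |p.eval x - g x| < δ := by
  obtain ⟨R, hR⟩ := hK.isBounded.subset_closedBall 0
  obtain ⟨p, hp⟩ := exists_polynomial_near_of_continuousOn (-R) R g hg.continuousOn δ hδ
  refine ⟨p, fun x hx => hp x ?_⟩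
  have := hR hx
  rw [Real.closedBall_eq_Icc] at this
  simpa using this

/-- Finite compactly supported measures on the line are determined by their moments. -/
theorem MeasureTheory.Measure.ext_of_moments {μ ν : Measure ℝ} [IsFiniteMeasure μ]
    [IsFiniteMeasure ν] {K : Set ℝ} (hK : IsCompact K) (hμ : μ Kᶜ = 0) (hν : ν Kᶜ = 0)
    (h : ∀ n : ℕ, ∫ x, x ^ n ∂μ = ∫ x, x ^ n ∂ν) : μ = ν := by
  have hpoly : ∀ p : Polynomial ℝ, ∫ x, p.eval x ∂μ = ∫ x, p.eval x ∂ν := by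
    intro p
    simp only [Polynomial.eval_eq_sum_range]
    rw [integral_finsetSum, integral_finsetSum]
    · simp only [integral_const_mul, h]
    · exact fun i _ => Continuous.integrable_of_ae_mem_isCompact hK hν (by fun_prop)
    · exact fun i _ => Continuous.integrable_of_ae_mem_isCompact hK hμ (by fun_prop)
  refine ext_of_forall_integral_eq_of_IsFiniteMeasure fun g => ?_
  have key : ∀ (ρ : Measure ℝ) [IsFiniteMeasure ρ], ρ Kᶜ = 0 → ∀ (p : Polynomial ℝ) (δ : ℝ),
      (∀ x ∈ K, |p.eval x - g x| < δ) →
        |∫ x, p.eval x ∂ρ - ∫ x, g x ∂ρ| ≤ δ * ρ.real Set.univ := by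
    intro ρ _ hρ p δ hp
    rw [← integral_sub (Continuous.integrable_of_ae_mem_isCompact hK hρ p.continuous)
      (Continuous.integrable_of_ae_mem_isCompact hK hρ g.continuous), ← Real.norm_eq_abs]
    refine norm_integral_le_of_norm_le_const ?_
    filter_upwards [mem_ae_iff.mpr hρ] with x hx using (hp x hx).le
  set M : ℝ := μ.real Set.univ + ν.real Set.univ + 1
  have hM : 0 < M := by positivity
  refine eq_of_abs_sub_le_all fun ε hε => ?_
  obtain ⟨p, hp⟩ := hK.exists_polynomial_near g.continuous (div_pos hε hM)
  have h1 := key μ hμ p _ hp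
  have h2 := key ν hν p _ hp
  have h3 : ε / M * μ.real Set.univ + ε / M * ν.real Set.univ ≤ ε := by
    rw [← mul_add, div_mul_eq_mul_div, div_le_iff₀ hM]
    exact mul_le_mul_of_nonneg_left (by simp [M]) hε.le
  rw [hpoly p] at h1
  rw [abs_le] at *
  constructor <;> linarith [h1.1, h1.2, h2.1, h2.2]

/-- The polynomials are dense in `L²` of a finite compactly supported measure. -/
lemma exists_polynomial_integral_sq_sub_indicator_le {μ : Measure ℝ} [IsFiniteMeasure μ]
    {K : Set ℝ} (hK : IsCompact K) (hμ : μ Kᶜ = 0) {S : Set ℝ} (hS : MeasurableSet S)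
    {ε : ℝ} (hε : 0 < ε) :
    ∃ p : Polynomial ℝ, ∫ x, (p.eval x - S.indicator 1 x) ^ 2 ∂μ ≤ ε := by
  have hmem : MemLp (S.indicator (1 : ℝ → ℝ)) (ENNReal.ofReal 2) μ :=
    memLp_indicator_const _ hS (1 : ℝ) (Or.inr (measure_ne_top _ _))
  -- By `(x + y)² ≤ 2x² + 2y²`, an error `ε / 4` for `g` in mean square and a uniform error `δ` with
  -- `δ² = ε / (4M)` for `p` contribute `ε / 2` each. The `+ 1` in `M` keeps it positive when `μ =
  -- 0`.
  obtain ⟨g, hg, hgm⟩ := hmem.exists_boundedContinuous_integral_rpow_sub_le (by norm_num)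
    (show 0 < ε / 4 by positivity)
  set M : ℝ := μ.real Set.univ + 1
  have hM : 0 < M := by positivity
  set δ : ℝ := Real.sqrt (ε / (4 * M))
  have hδ : 0 < δ := by positivity
  have hδ2 : δ ^ 2 = ε / (4 * M) := Real.sq_sqrt (by positivity)
  obtain ⟨p, hp⟩ := hK.exists_polynomial_near g.continuous hδ
  refine ⟨p, ?_⟩
  have hgi : Integrable (fun x => (S.indicator 1 x - g x) ^ 2) μ := by
    have := (hmem.sub hgm).integrable_norm_rpow (by norm_num) (by norm_num)
    simpa using this
  have hle : ∀ᵐ x ∂μ, (p.eval x - S.indicator 1 x) ^ 2 ≤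
      2 * (S.indicator 1 x - g x) ^ 2 + 2 * δ ^ 2 := by
    filter_upwards [mem_ae_iff.mpr hμ] with x hx
    have h1 := hp x hx
    have h2 : (p.eval x - g x) ^ 2 ≤ δ ^ 2 := sq_le_sq' (by linarith [(abs_lt.mp h1).1])
      (abs_lt.mp h1).2.le
    nlinarith [sq_nonneg ((p.eval x - g x) + (S.indicator 1 x - g x))]
  have h3 : ∫ x, (S.indicator 1 x - g x) ^ 2 ∂μ ≤ ε / 4 := by simpa using hg
  calc ∫ x, (p.eval x - S.indicator 1 x) ^ 2 ∂μ
      ≤ ∫ x, (2 * (S.indicator 1 x - g x) ^ 2 + 2 * δ ^ 2) ∂μ :=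
        integral_mono_of_nonneg (Filter.Eventually.of_forall fun x => sq_nonneg _)
          ((hgi.const_mul 2).add (integrable_const _)) hle
    _ = 2 * ∫ x, (S.indicator 1 x - g x) ^ 2 ∂μ + 2 * δ ^ 2 * μ.real Set.univ := by
        rw [integral_add (hgi.const_mul 2) (integrable_const _), integral_const_mul]
        simp [mul_comm]
    _ ≤ ε := by
        have : 2 * δ ^ 2 * μ.real Set.univ ≤ ε / 2 := by
          rw [hδ2]
          have : 2 * (ε / (4 * M)) * μ.real Set.univ = ε / 2 * (μ.real Set.univ / M) := by
            field_simp; ring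
          rw [this]
          refine mul_le_of_le_one_right (by positivity) ?_
          rw [div_le_one hM]
          simp [M]
        linarith

/-! ### Polynomial calculus, spectral projections and singularity. -/

namespace IsSpectralMeasure

variable {T : selfAdjoint (E →L[ℂ] E)} {f : E} {μ : Measure ℝ}

lemma integral_eval (h : IsSpectralMeasure T f μ) (p : Polynomial ℝ) :
    ((∫ x, p.eval x ∂μ : ℝ) : ℂ) =
      inner ℂ f (Polynomial.aeval T.1 (p.map Complex.ofRealHom) f) := by
  have := h.finite
  obtain ⟨K, hK, hμ⟩ := h.compact_support
  induction p using Polynomial.induction_on' with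
  | add p q hp hq =>
    simp only [Polynomial.eval_add, Polynomial.map_add, map_add]
    rw [integral_add (Continuous.integrable_of_ae_mem_isCompact hK hμ p.continuous)
      (Continuous.integrable_of_ae_mem_isCompact hK hμ q.continuous), Complex.ofReal_add, hp, hq,
      ← inner_add_right]
    rfl
  | monomial n a =>
    simp only [Polynomial.eval_monomial]
    rw [Polynomial.map_monomial, Polynomial.aeval_monomial, ← Algebra.smul_def, integral_const_mul,
      Complex.ofReal_mul, h.moment]
    exact (inner_smul_right _ _ _).symm

lemma integral_eval_mul_eval (h : IsSpectralMeasure T f μ) (p q : Polynomial ℝ) :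
    ((∫ x, p.eval x * q.eval x ∂μ : ℝ) : ℂ) =
      inner ℂ (Polynomial.aeval T.1 (p.map Complex.ofRealHom) f)
        (Polynomial.aeval T.1 (q.map Complex.ofRealHom) f) := by
  have h1 := Polynomial.isSelfAdjoint_aeval_map_ofReal T.2 p
  rw [ContinuousLinearMap.isSelfAdjoint_iff_isSymmetric] at h1
  simp only [← Polynomial.eval_mul]
  rw [h.integral_eval, Polynomial.map_mul, map_mul]
  exact (h1 f _).symm

/-- The isometry `p ↦ p(T) f` from the polynomials in `L²(μ)`; it lets mean-square limits of
polynomials act on `f` without a Borel functional calculus. -/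
lemma norm_sq_aeval (h : IsSpectralMeasure T f μ) (p : Polynomial ℝ) :
    ‖Polynomial.aeval T.1 (p.map Complex.ofRealHom) f‖ ^ 2 = ∫ x, p.eval x ^ 2 ∂μ := by
  rw [← inner_self_eq_norm_sq (𝕜 := ℂ), ← h.integral_eval_mul_eval p p]
  simp only [sq]
  exact Complex.ofReal_re _

/-- The spectral projection of a set `S` applied to a vector with spectral measure `μ` is a
vector with spectral measure `μ.restrict S`. -/
theorem exists_restrict (h : IsSpectralMeasure T f μ) {S : Set ℝ} (hS : MeasurableSet S) :
    ∃ g : E, IsSpectralMeasure T g (μ.restrict S) := by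
  have := h.finite
  obtain ⟨K, hK, hμ⟩ := h.compact_support
  set χ : ℝ → ℝ := S.indicator 1
  have hχm : Measurable χ := measurable_one.indicator hS
  have hχ0 : ∀ x, 0 ≤ χ x := fun x => Set.indicator_nonneg (by simp) _
  have hχ1 : ∀ x, χ x ≤ 1 := fun x => Set.indicator_le_self' (by simp) _
  set ε : ℕ → ℝ := fun m => 1 / ((m : ℝ) + 1)
  have hε : ∀ m, 0 < ε m := fun m => Nat.one_div_pos_of_nat
  have hε0 : Filter.Tendsto ε Filter.atTop (nhds 0) := tendsto_one_div_add_atTop_nhds_zero_nat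
  choose p hp using fun m => exists_polynomial_integral_sq_sub_indicator_le hK hμ hS
    (pow_pos (hε m) 2)
  have hbdd : ∀ (w : ℝ → ℝ), Continuous w → ∃ C : ℝ, 0 ≤ C ∧ ∀ᵐ x ∂μ, |w x| ≤ C := by
    intro w hw
    obtain ⟨C, hC⟩ := hK.exists_bound_of_continuousOn hw.continuousOn
    refine ⟨max C 0, le_max_right _ _, ?_⟩
    filter_upwards [mem_ae_iff.mpr hμ] with x hx using le_max_of_le_left (hC x hx)
  have hmulχ : ∀ (w : ℝ → ℝ), Continuous w → Integrable (fun x => w x * χ x) μ := by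
    intro w hw
    refine (Continuous.integrable_of_ae_mem_isCompact hK hμ hw).mono (by fun_prop) ?_
    refine Filter.Eventually.of_forall fun x => ?_
    rw [norm_mul]
    refine mul_le_of_le_one_right (norm_nonneg _) ?_
    rw [Real.norm_of_nonneg (hχ0 x)]
    exact hχ1 x
  have hχsq : ∀ x, χ x ^ 2 = χ x := by
    intro x
    by_cases hx : x ∈ S <;> simp [χ, hx]
  have hint : ∀ m, Integrable (fun x => ((p m).eval x - χ x) ^ 2) μ := by
    intro m
    have h1 : Integrable (fun x => (p m).eval x ^ 2) μ :=
      Continuous.integrable_of_ae_mem_isCompact hK hμ ((p m).continuous.pow 2)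
    have h2 := hmulχ (fun x => 1 - 2 * (p m).eval x)
      (continuous_const.sub (continuous_const.mul (p m).continuous))
    refine (h1.add h2).congr (Filter.Eventually.of_forall fun x => ?_)
    simp only [Pi.add_apply, sub_sq, hχsq]
    ring
  -- The polynomials `p m` converge to the indicator `χ` in `L²(μ)`, so by isometry the vectors `p m
  -- (T) f` form a Cauchy sequence; the limit plays the role of `χ(T) f`.
  set F : ℕ → E := fun m => Polynomial.aeval T.1 ((p m).map Complex.ofRealHom) f
  have hF : ∀ m l, ‖F m - F l‖ ^ 2 ≤ 2 * ε m ^ 2 + 2 * ε l ^ 2 := by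
    intro m l
    have e1 : F m - F l = Polynomial.aeval T.1 ((p m - p l).map Complex.ofRealHom) f := by
      rw [Polynomial.map_sub, map_sub]
      rfl
    rw [e1, h.norm_sq_aeval]
    calc ∫ x, (p m - p l).eval x ^ 2 ∂μ
        ≤ ∫ x, (2 * ((p m).eval x - χ x) ^ 2 + 2 * ((p l).eval x - χ x) ^ 2) ∂μ := by
          refine integral_mono
            (Continuous.integrable_of_ae_mem_isCompact hK hμ ((p m - p l).continuous.pow 2))
            (((hint m).const_mul 2).add ((hint l).const_mul 2)) fun x => ?_
          simp only [Polynomial.eval_sub]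
          nlinarith [sq_nonneg (((p m).eval x - χ x) + ((p l).eval x - χ x))]
      _ = 2 * ∫ x, ((p m).eval x - χ x) ^ 2 ∂μ + 2 * ∫ x, ((p l).eval x - χ x) ^ 2 ∂μ := by
          rw [integral_add ((hint m).const_mul 2) ((hint l).const_mul 2), integral_const_mul,
            integral_const_mul]
      _ ≤ _ := by linarith [hp m, hp l]
  have hcauchy : CauchySeq F := by
    refine cauchySeq_of_le_tendsto_0 (fun N => 2 * ε N) (fun m l N hm hl => ?_)
      (by simpa using hε0.const_mul 2)
    have hanti : ∀ m, N ≤ m → ε m ≤ ε N := fun m hm => Nat.one_div_le_one_div hm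
    rw [dist_eq_norm]
    refine le_of_sq_le_sq ?_ (by linarith [hε N])
    refine (hF m l).trans ?_
    have a1 := pow_le_pow_left₀ (hε m).le (hanti m hm) 2
    have a2 := pow_le_pow_left₀ (hε l).le (hanti l hl) 2
    nlinarith
  obtain ⟨g, hg⟩ := cauchySeq_tendsto_of_complete hcauchy
  refine ⟨g, inferInstance, ⟨K, hK, le_antisymm ?_ bot_le⟩, fun n => ?_⟩
  · exact (Measure.restrict_apply_le _ _).trans_eq hμ
  have e0 : ∫ x, x ^ n ∂(μ.restrict S) = ∫ x, x ^ n * χ x ∂μ := by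
    rw [← integral_indicator hS]
    refine integral_congr_ae (Filter.Eventually.of_forall fun x => ?_)
    by_cases hx : x ∈ S <;> simp [χ, hx]
  have e1 : ∀ m, inner ℂ (F m) ((T.1 ^ n) (F m)) =
      ((∫ x, x ^ n * (p m).eval x ^ 2 ∂μ : ℝ) : ℂ) := by
    intro m
    have a1 : (T.1 ^ n) (F m) =
        Polynomial.aeval T.1 ((Polynomial.X ^ n * p m).map Complex.ofRealHom) f := by
      simp only [Polynomial.map_mul, Polynomial.map_pow, Polynomial.map_X, map_mul, map_pow,
        Polynomial.aeval_X]
      rfl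
    rw [a1, ← h.integral_eval_mul_eval]
    congr 1
    refine integral_congr_ae (Filter.Eventually.of_forall fun x => ?_)
    simp only [Polynomial.eval_mul, Polynomial.eval_pow, Polynomial.eval_X]
    ring
  have lim1 : Filter.Tendsto (fun m => inner ℂ (F m) ((T.1 ^ n) (F m))) Filter.atTop
      (nhds (inner ℂ g ((T.1 ^ n) g))) :=
    hg.inner (((T.1 ^ n).continuous.tendsto g).comp hg)
  have lim2 : Filter.Tendsto (fun m => ∫ x, x ^ n * (p m).eval x ^ 2 ∂μ) Filter.atTop
      (nhds (∫ x, x ^ n * χ x ∂μ)) := by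
    obtain ⟨C, hC0, hC⟩ := hbdd (fun x => x ^ n) (by fun_prop)
    rw [tendsto_iff_norm_sub_tendsto_zero]
    -- With `y = p m - χ` and `χ² = χ`, one has `|(p m)² - χ| ≤ y² + 2|y|`. The weighted bound `2|y|
    -- ≤ y² / ε + ε` and `∫ y² ≤ ε²` make the integral `O(ε)`.
    refine squeeze_zero (fun m => norm_nonneg _)
      (g := fun m => C * ((1 + 1 / ε m) * ε m ^ 2 + ε m * μ.real Set.univ)) (fun m => ?_) ?_
    · have b0 : Integrable (fun x => x ^ n * (p m).eval x ^ 2) μ :=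
        Continuous.integrable_of_ae_mem_isCompact hK hμ
          ((continuous_pow n).mul ((p m).continuous.pow 2))
      rw [← integral_sub b0 (hmulχ _ (continuous_pow n))]
      have b1 : ∀ᵐ x ∂μ, ‖x ^ n * (p m).eval x ^ 2 - x ^ n * χ x‖ ≤
          C * ((1 + 1 / ε m) * ((p m).eval x - χ x) ^ 2 + ε m) := by
        filter_upwards [hC] with x hx
        rw [← mul_sub, norm_mul]
        refine mul_le_mul hx ?_ (norm_nonneg _) hC0
        set y := (p m).eval x - χ x
        have c1 : (p m).eval x ^ 2 - χ x = y ^ 2 + 2 * y * χ x := by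
          have : y = (p m).eval x - χ x := rfl
          rw [this]
          linear_combination hχsq x
        have c2 : 2 * |y| ≤ 1 / ε m * y ^ 2 + ε m := by
          have := sq_nonneg (|y| - ε m)
          rw [← sq_abs y]
          have h5 : 1 / ε m * |y| ^ 2 + ε m - 2 * |y| = 1 / ε m * (|y| - ε m) ^ 2 := by
            have := (hε m).ne'
            field_simp
            ring
          have h6 : 0 ≤ 1 / ε m * (|y| - ε m) ^ 2 :=
            mul_nonneg (one_div_nonneg.mpr (hε m).le) this
          linarith
        rw [c1, Real.norm_eq_abs]
        calc |y ^ 2 + 2 * y * χ x| ≤ |y ^ 2| + |2 * y * χ x| := abs_add_le _ _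
          _ ≤ y ^ 2 + 2 * |y| := by
              rw [abs_of_nonneg (sq_nonneg y), abs_mul, abs_mul, abs_of_nonneg (hχ0 x), abs_two]
              have := mul_le_of_le_one_right (show 0 ≤ 2 * |y| by positivity) (hχ1 x)
              linarith
          _ ≤ _ := by linarith
      have b2 : Integrable (fun x => (1 + 1 / ε m) * ((p m).eval x - χ x) ^ 2 + ε m) μ :=
        ((hint m).const_mul _).add (integrable_const _)
      refine (norm_integral_le_of_norm_le (b2.const_mul C) b1).trans ?_
      rw [integral_const_mul, integral_add ((hint m).const_mul _) (integrable_const _),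
        integral_const_mul, integral_const, smul_eq_mul, mul_comm (μ.real _)]
      have : 0 ≤ 1 + 1 / ε m := by have := hε m; positivity
      gcongr
      exact hp m
    · have b3 : (fun m => C * ((1 + 1 / ε m) * ε m ^ 2 + ε m * μ.real Set.univ)) =
          fun m => C * (ε m ^ 2 + ε m + ε m * μ.real Set.univ) := by
        ext m
        have := (hε m).ne'
        field_simp
      rw [b3]
      simpa using ((((hε0.pow 2).add hε0).add (hε0.mul_const _)).const_mul C)
  have lim3 := (Complex.continuous_ofReal.tendsto _).comp lim2
  rw [e0]
  refine tendsto_nhds_unique ?_ lim1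
  simp only [e1]
  exact lim3

/-- The moment of order zero is both the total mass of `μ` and `‖f‖²`. -/
lemma eq_zero_of_vector_eq_zero (h : IsSpectralMeasure T f μ) (hf : f = 0) : μ = 0 := by
  have := h.finite
  have h0 := h.moment 0
  subst hf
  simpa [measureReal_eq_zero_iff] using h0

/-- If the absolutely continuous spectrum is empty then all spectral measures are singular. -/
theorem mutuallySingular_volume (h : IsSpectralMeasure T f μ)
    (hT : ¬ (acSpectrum T).Nonempty) : μ ⟂ₘ volume := by
  have := h.finite
  -- A nonzero such vector would make `acSubspace T` a nontrivial complex Banach space, on which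
  -- every bounded operator has nonempty spectrum.
  have hac : ∀ g ∈ acVectors T, g = 0 := by
    intro g hg
    by_contra hne
    refine hT ?_
    have hg' : g ∈ acSubspace T := Submodule.le_topologicalClosure _ (Submodule.subset_span hg)
    have : Nontrivial (acSubspace T) :=
      ⟨⟨g, hg'⟩, 0, fun h0 => hne (congrArg Subtype.val h0)⟩
    have : CompleteSpace (acSubspace T) :=
      (Submodule.isClosed_topologicalClosure _).completeSpace_coe
    exact spectrum.nonempty (acPart T)
  -- `S` is null for the singular part and its complement is Lebesgue null, so `μ.restrict S` is
  -- absolutely continuous. The vector realising it must be zero, which forces `μ S = 0`.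
  obtain ⟨S, hS, h1, h2⟩ := Measure.mutuallySingular_singularPart μ volume
  have hres : μ.restrict S ≪ volume := by
    rw [Measure.haveLebesgueDecomposition_add μ volume, Measure.restrict_add,
      Measure.restrict_eq_zero.mpr h1, zero_add]
    exact Measure.absolutelyContinuous_of_le Measure.restrict_le_self |>.trans
      (withDensity_absolutelyContinuous _ _)
  obtain ⟨g, hg⟩ := h.exists_restrict hS
  have hg0 := hg.eq_zero_of_vector_eq_zero (hac g ⟨_, hg, hres⟩)
  exact ⟨S, hS, Measure.restrict_eq_zero.mp hg0, h2⟩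

end IsSpectralMeasure

end SpectralMeasures

/-! ### Perturbation of ordered eigenvalues; Lipschitz functions with values in a null set. -/

section Eigenvalues

namespace LinearMap.IsSymmetric

variable {E : Type*} [NormedAddCommGroup E] [InnerProductSpace ℂ E] [FiniteDimensional ℂ E]
  {N : ℕ} {S T : E →ₗ[ℂ] E}

lemma re_inner_self_apply (hS : S.IsSymmetric) (hN : Module.finrank ℂ E = N) (x : E) :
    (inner ℂ x (S x)).re =
      ∑ i, hS.eigenvalues hN i * ‖inner ℂ (hS.eigenvectorBasis hN i) x‖ ^ 2 := by
  rw [← (hS.eigenvectorBasis hN).sum_inner_mul_inner x (S x), Complex.re_sum]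
  refine Finset.sum_congr rfl fun i _ => ?_
  have h1 := hS.eigenvectorBasis_apply_self_apply hN x i
  rw [OrthonormalBasis.repr_apply_apply, OrthonormalBasis.repr_apply_apply] at h1
  rw [h1, ← inner_conj_symm x, mul_left_comm, Complex.conj_mul', ← Complex.ofReal_pow]
  exact (Complex.re_ofReal_mul _ _).trans (by rw [Complex.ofReal_re]; rfl)

/-- Only the indices `i ≤ j` contribute to `x`, and there the eigenvalues are at least the `j`-th,
as they are listed in decreasing order. -/
lemma eigenvalues_mul_norm_sq_le (hS : S.IsSymmetric) (hN : Module.finrank ℂ E = N) (j : Fin N)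
    {x : E} (hx : ∀ i, j < i → inner ℂ (hS.eigenvectorBasis hN i) x = 0) :
    hS.eigenvalues hN j * ‖x‖ ^ 2 ≤ (inner ℂ x (S x)).re := by
  rw [hS.re_inner_self_apply hN, ← (hS.eigenvectorBasis hN).sum_sq_norm_inner_right x,
    Finset.mul_sum]
  refine Finset.sum_le_sum fun i _ => ?_
  rcases lt_or_ge j i with h | h
  · simp [hx i h]
  · exact mul_le_mul_of_nonneg_right (hS.eigenvalues_antitone hN h) (by positivity)

lemma le_eigenvalues_mul_norm_sq (hS : S.IsSymmetric) (hN : Module.finrank ℂ E = N) (j : Fin N)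
    {x : E} (hx : ∀ i, i < j → inner ℂ (hS.eigenvectorBasis hN i) x = 0) :
    (inner ℂ x (S x)).re ≤ hS.eigenvalues hN j * ‖x‖ ^ 2 := by
  rw [hS.re_inner_self_apply hN, ← (hS.eigenvectorBasis hN).sum_sq_norm_inner_right x,
    Finset.mul_sum]
  refine Finset.sum_le_sum fun i _ => ?_
  rcases lt_or_ge i j with h | h
  · simp [hx i h]
  · exact mul_le_mul_of_nonneg_right (hS.eigenvalues_antitone hN h) (by positivity)

/-- **Weyl's inequality** for the ordered eigenvalues of symmetric operators. -/
theorem eigenvalues_le_eigenvalues_add (hS : S.IsSymmetric) (hT : T.IsSymmetric)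
    (hN : Module.finrank ℂ E = N) {C : ℝ}
    (hC : ∀ x, (inner ℂ x (S x)).re ≤ (inner ℂ x (T x)).re + C * ‖x‖ ^ 2) (j : Fin N) :
    hS.eigenvalues hN j ≤ hT.eigenvalues hN j + C := by
  obtain ⟨x, hx0, hx1, hx2⟩ : ∃ x : E, x ≠ 0 ∧
      (∀ i, j < i → inner ℂ (hS.eigenvectorBasis hN i) x = 0) ∧
      (∀ i, i < j → inner ℂ (hT.eigenvectorBasis hN i) x = 0) := by
    -- The conditions on `x` involve the eigenvectors of `S` after `j` and those of `T` before `j`.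
    -- These are `N - 1` linear conditions in dimension `N`, so a nonzero solution exists.
    let L : E →ₗ[ℂ] ({i : Fin N // i ≠ j} → ℂ) := LinearMap.pi fun i =>
      if j < i.1 then (innerₛₗ ℂ (hS.eigenvectorBasis hN i)) else
        (innerₛₗ ℂ (hT.eigenvectorBasis hN i))
    have hpos : 0 < N := j.pos
    have hlt : Module.finrank ℂ ({i : Fin N // i ≠ j} → ℂ) < Module.finrank ℂ E := by
      rw [Module.finrank_fintype_fun_eq_card, hN, Fintype.card_subtype_compl]
      simp [hpos]
    obtain ⟨x, hx, hx0⟩ := (Submodule.ne_bot_iff _).mp (LinearMap.ker_ne_bot_of_finrank_lt hlt)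
    have hLx : L x = 0 := hx
    refine ⟨x, hx0, fun i hi => ?_, fun i hi => ?_⟩
    · have := congrFun hLx ⟨i, hi.ne'⟩
      simpa [L, hi] using this
    · have := congrFun hLx ⟨i, hi.ne⟩
      simpa [L, hi.not_gt] using this
  have h1 := hS.eigenvalues_mul_norm_sq_le hN j hx1
  have h2 := hT.le_eigenvalues_mul_norm_sq hN j hx2
  have h3 : 0 < ‖x‖ ^ 2 := by positivity
  have h4 := hC x
  by_contra! h
  nlinarith

end LinearMap.IsSymmetric

namespace Matrix.IsHermitian

variable {n : Type*} [Fintype n] [DecidableEq n] {A B : Matrix n n ℂ}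

lemma re_inner_toEuclideanLin_le {D : Matrix n n ℂ} {δ : ℝ} (hD : ∀ i j, ‖D i j‖ ≤ δ)
    (x : EuclideanSpace ℂ n) :
    (inner ℂ x (Matrix.toEuclideanLin D x)).re ≤ (Fintype.card n) ^ 2 * δ * ‖x‖ ^ 2 := by
  refine (Complex.re_le_norm _).trans ?_
  rw [PiLp.inner_apply]
  have hx : ∀ i, ‖x i‖ ≤ ‖x‖ := fun i => PiLp.norm_apply_le x i
  have h1 : ∀ i, ‖(Matrix.toEuclideanLin D x) i‖ ≤ Fintype.card n * δ * ‖x‖ := by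
    intro i
    have : (Matrix.toEuclideanLin D x) i = ∑ j, D i j * x j := by
      simp [Matrix.toLpLin_apply, Matrix.mulVec, dotProduct]
    rw [this]
    refine (norm_sum_le _ _).trans ?_
    calc ∑ j, ‖D i j * x j‖ ≤ ∑ j : n, δ * ‖x‖ := by
          refine Finset.sum_le_sum fun j _ => ?_
          rw [norm_mul]
          exact mul_le_mul (hD i j) (hx j) (norm_nonneg _) ((norm_nonneg _).trans (hD i j))
      _ = Fintype.card n * δ * ‖x‖ := by simp [mul_assoc]
  refine (norm_sum_le _ _).trans ?_
  calc ∑ i, ‖inner ℂ (x i) ((Matrix.toEuclideanLin D x) i)‖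
      ≤ ∑ i : n, ‖x‖ * (Fintype.card n * δ * ‖x‖) := by
        refine Finset.sum_le_sum fun i _ => (norm_inner_le_norm _ _).trans ?_
        exact mul_le_mul (hx i) (h1 i) (norm_nonneg _) (norm_nonneg _)
    _ = (Fintype.card n) ^ 2 * δ * ‖x‖ ^ 2 := by
        simp
        ring

/-- The ordered eigenvalues of a Hermitian matrix are Lipschitz functions of the entries. -/
theorem abs_eigenvalues₀_sub_le (hA : A.IsHermitian) (hB : B.IsHermitian) {δ : ℝ}
    (h : ∀ i j, ‖A i j - B i j‖ ≤ δ) (k : Fin (Fintype.card n)) :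
    |hA.eigenvalues₀ k - hB.eigenvalues₀ k| ≤ (Fintype.card n) ^ 2 * δ := by
  have key : ∀ {A B : Matrix n n ℂ} (hA : A.IsHermitian) (hB : B.IsHermitian),
      (∀ i j, ‖A i j - B i j‖ ≤ δ) →
        hA.eigenvalues₀ k ≤ hB.eigenvalues₀ k + (Fintype.card n) ^ 2 * δ := by
    intro A B hA hB h
    refine LinearMap.IsSymmetric.eigenvalues_le_eigenvalues_add _ _ _ (fun x => ?_) k
    have := re_inner_toEuclideanLin_le (D := A - B) h x
    rw [map_sub, LinearMap.sub_apply, inner_sub_right, Complex.sub_re] at this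
    linarith
  have h1 := key hA hB h
  have h2 := key hB hA fun i j => by rw [norm_sub_rev]; exact h i j
  rw [abs_le]
  constructor <;> linarith

/-- Traces of powers are polynomial in the entries, so they see the eigenvalues while staying
analytic in parameters even where eigenvalues cross. -/
lemma trace_pow_eq_sum_eigenvalues₀ (hA : A.IsHermitian) (m : ℕ) :
    (A ^ m).trace = ((∑ k, hA.eigenvalues₀ k ^ m : ℝ) : ℂ) := by
  conv_lhs => rw [hA.spectral_theorem, ← map_pow, Unitary.conjStarAlgAut_apply,
    Matrix.trace_mul_cycle, Unitary.coe_star_mul_self, one_mul, Matrix.diagonal_pow,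
    Matrix.trace_diagonal]
  simp only [Pi.pow_apply, Function.comp_apply, eigenvalues]
  rw [Complex.ofReal_sum,
    ← Equiv.sum_comp (Fintype.equivOfCardEq (Fintype.card_fin (Fintype.card n))).symm]
  simp

end Matrix.IsHermitian

/-- A Lipschitz function on the line with almost all values in a null set is constant. -/
lemma LipschitzWith.eq_of_ae_mem_null {f : ℝ → ℝ} {C : NNReal} (hf : LipschitzWith C f)
    {B : Set ℝ} (hB : volume B = 0) (h : ∀ᵐ s, f s ∈ B) (s s' : ℝ) : f s = f s' := by
  have himage : volume (Set.range f) = 0 := by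
    have h1 : Set.range f ⊆ B ∪ f '' {s | f s ∉ B} := by
      rintro _ ⟨s, rfl⟩
      by_cases hs : f s ∈ B
      · exact Or.inl hs
      · exact Or.inr ⟨s, hs, rfl⟩
    refine measure_mono_null h1 (measure_union_null hB ?_)
    -- One-dimensional Hausdorff measure is Lebesgue measure on the line, and a Lipschitz map sends
    -- null sets to null sets.
    have h2 := hf.hausdorffMeasure_image_le zero_le_one {s | f s ∉ B}
    rw [hausdorffMeasure_real, ae_iff.mp h, mul_zero] at h2
    exact le_antisymm h2 bot_le
  -- The range is an interval of measure zero, hence a single point.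
  have hconn : Set.OrdConnected (Set.range f) :=
    (isPreconnected_range hf.continuous).ordConnected
  have key : ∀ s s', f s ≤ f s' := by
    intro s s'
    by_contra! hlt
    have h3 : volume (Set.Icc (f s') (f s)) ≤ volume (Set.range f) :=
      measure_mono (hconn.out ⟨s', rfl⟩ ⟨s, rfl⟩)
    rw [himage, Real.volume_Icc] at h3
    simp only [nonpos_iff_eq_zero, ENNReal.ofReal_eq_zero] at h3
    linarith
  exact le_antisymm (key s s') (key s' s)

end Eigenvalues

/-! ### Characters of the torus and functions with singular distribution. -/

namespace UnitAddTorus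

variable {d : ℕ}

/-- The Haar probability measure on the torus. -/
def haar (d : ℕ) : Measure (UnitAddTorus (Fin d)) :=
  Measure.pi fun _ => AddCircle.haarAddCircle

instance : IsProbabilityMeasure (haar d) := by unfold haar; infer_instance

instance : (haar d).IsAddLeftInvariant := by unfold haar; infer_instance

instance : (haar d).IsOpenPosMeasure := by unfold haar; infer_instance

/-- The one-parameter subgroup of the torus with direction `ω`. -/
def line (ω : Fin d → ℝ) (s : ℝ) : UnitAddTorus (Fin d) := fun i => ((s * ω i : ℝ) : UnitAddCircle)

lemma line_zero (ω : Fin d → ℝ) : line ω 0 = 0 := by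
  ext i
  simp [line]

lemma continuous_line (ω : Fin d → ℝ) : Continuous (line ω) :=
  continuous_pi fun _ => (AddCircle.continuous_mk' 1).comp (continuous_id.mul continuous_const)

lemma exists_line_eq (k : UnitAddTorus (Fin d)) : ∃ ω, line ω 1 = k := by
  choose ω hω using fun i => QuotientAddGroup.mk_surjective (k i)
  refine ⟨ω, funext fun i => ?_⟩
  simpa [line] using hω i

lemma mFourier_add_apply (n : Fin d → ℤ) (k h : UnitAddTorus (Fin d)) :
    mFourier n (k + h) = mFourier n k * mFourier n h := by
  simp [mFourier, fourier_apply, Finset.prod_mul_distrib, AddCircle.toCircle_add]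

lemma mFourier_line (n : Fin d → ℤ) (ω : Fin d → ℝ) (s : ℝ) :
    mFourier n (line ω s) =
      Complex.exp (Complex.I * ((2 * Real.pi * ∑ i, n i * ω i) * s : ℝ)) := by
  simp only [mFourier, line, ContinuousMap.coe_mk, fourier_coe_apply]
  rw [← Complex.exp_sum]
  congr 1
  push_cast
  rw [Finset.mul_sum, Finset.sum_mul, Finset.mul_sum]
  refine Finset.sum_congr rfl fun i _ => ?_
  ring

lemma integrable_of_continuous {E : Type*} [NormedAddCommGroup E] {f : UnitAddTorus (Fin d) → E}
    (hf : Continuous f) : Integrable f (haar d) :=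
  hf.integrable_of_hasCompactSupport (HasCompactSupport.of_compactSpace f)

/-- If `n i ≠ 0`, translation by `1 / (2 n i)` in the `i`-th coordinate changes the sign of the
character but not its integral. -/
lemma integral_mFourier (n : Fin d → ℤ) :
    ∫ k, mFourier n k ∂(haar d) = if n = 0 then 1 else 0 := by
  split_ifs with h
  · subst h
    simp [mFourier_zero]
  · obtain ⟨i, hi⟩ := Function.ne_iff.mp h
    have h1 : ∫ k, mFourier n (Pi.single i (((1 / 2 / n i : ℝ)) : UnitAddCircle) + k) ∂(haar d) =
        ∫ k, mFourier n k ∂(haar d) := integral_add_left_eq_self _ _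
    have h2 : mFourier n (Pi.single i (((1 / 2 / n i : ℝ)) : UnitAddCircle)) = -1 := by
      have h3 := fourier_add_half_inv_index hi one_pos (0 : UnitAddCircle)
      rw [zero_add, fourier_eval_zero] at h3
      rw [← h3]
      change ∏ j, fourier (n j)
        ((Pi.single i (((1 / 2 / n i : ℝ)) : UnitAddCircle) : UnitAddTorus (Fin d)) j) = _
      rw [Finset.prod_eq_single i _ (by simp), Pi.single_eq_same]
      intro j _ hj
      rw [Pi.single_eq_of_ne hj, fourier_eval_zero]
    simp only [mFourier_add_apply, h2, integral_const_mul] at h1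
    linear_combination (-1 / 2 : ℂ) * h1

/-- A continuous function on the torus which is Lipschitz along all one-parameter subgroups and
whose distribution is singular is constant. -/
theorem eq_of_mutuallySingular_map {f : UnitAddTorus (Fin d) → ℝ} (hf : Continuous f)
    (hlip : ∀ k ω, ∃ C, LipschitzWith C fun s => f (k + line ω s))
    (hsing : (haar d).map f ⟂ₘ volume) (k k' : UnitAddTorus (Fin d)) : f k = f k' := by
  obtain ⟨B, hB, h1, h2⟩ := hsing
  rw [Measure.map_apply hf.measurable hB] at h1
  have h3 : ∀ᵐ k ∂(haar d), f k ∈ Bᶜ := by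
    rw [ae_iff]
    simpa [Set.preimage] using h1
  have key : ∀ ω : Fin d → ℝ, ∀ k, f (k + line ω 1) = f k := by
    intro ω
    have hc : Continuous fun p : ℝ × UnitAddTorus (Fin d) => f (p.2 + line ω p.1) :=
      hf.comp (continuous_snd.add ((continuous_line ω).comp continuous_fst))
    -- Translation invariance gives this for each `s`. Exchanging the quantifiers by Fubini, for
    -- almost every `k` the function along the line through `k` lies in the null set `Bᶜ` for almost
    -- every `s`.
    have h4 : ∀ᵐ s : ℝ, ∀ᵐ k ∂(haar d), f (k + line ω s) ∈ Bᶜ := by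
      refine Filter.Eventually.of_forall fun s => ?_
      exact (measurePreserving_add_right (haar d) (line ω s)).quasiMeasurePreserving.ae h3
    rw [Measure.ae_ae_comm (p := fun s k => f (k + line ω s) ∈ Bᶜ)
      (hc.measurable hB.compl)] at h4
    have h5 : (fun k => f (k + line ω 1)) =ᵐ[haar d] f := by
      filter_upwards [h4] with k hk
      obtain ⟨C, hC⟩ := hlip k ω
      simpa [line_zero] using hC.eq_of_ae_mem_null h2 hk 1 0
    -- Haar measure charges every nonempty open set, so continuous functions equal almost everywhere
    -- are equal.
    have h6 : Continuous fun k => f (k + line ω 1) := hf.comp (continuous_id.add continuous_const)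
    exact congrFun ((h6.ae_eq_iff_eq _ hf).mp h5)
  obtain ⟨ω, hω⟩ := exists_line_eq (k - k')
  have := key ω k'
  rwa [hω, add_sub_cancel] at this

end UnitAddTorus

/-! ### Characters of the period lattice. -/

section Lattice

variable {d : ℕ} (a : Module.Basis (Fin d) ℝ (EuclideanSpace ℝ (Fin d)))

/-- The integer coordinates of a vector of the lattice. -/
def latticeCoords : periodLattice a →+ (Fin d → ℤ) where
  toFun γ i := (a.restrictScalars ℤ).repr γ i
  map_zero' := by ext i; simp
  map_add' γ γ' := by ext i; simp

lemma latticeCoords_injective : Function.Injective (latticeCoords a) := by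
  intro γ γ' h
  exact (a.restrictScalars ℤ).repr.injective (Finsupp.ext fun i => congrFun h i)

/-- The character of the lattice with quasimomentum `k`. -/
def latticeChar (γ : periodLattice a) (k : UnitAddTorus (Fin d)) : ℂ :=
  UnitAddTorus.mFourier (latticeCoords a γ) k

variable {a}

lemma continuous_latticeChar (γ : periodLattice a) : Continuous (latticeChar a γ) :=
  (UnitAddTorus.mFourier (latticeCoords a γ)).continuous

lemma latticeChar_zero (k : UnitAddTorus (Fin d)) : latticeChar a 0 k = 1 := by
  simp [latticeChar, UnitAddTorus.mFourier_zero]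

lemma latticeChar_add (γ γ' : periodLattice a) (k : UnitAddTorus (Fin d)) :
    latticeChar a (γ + γ') k = latticeChar a γ k * latticeChar a γ' k := by
  simp [latticeChar, UnitAddTorus.mFourier_add]

lemma latticeChar_neg (γ : periodLattice a) (k : UnitAddTorus (Fin d)) :
    latticeChar a (-γ) k = starRingEnd ℂ (latticeChar a γ k) := by
  simp [latticeChar, UnitAddTorus.mFourier_neg]

lemma integral_latticeChar (γ : periodLattice a) :
    ∫ k, latticeChar a γ k ∂(UnitAddTorus.haar d) = if γ = 0 then 1 else 0 := by
  simp only [latticeChar, UnitAddTorus.integral_mFourier,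
    map_eq_zero_iff _ (latticeCoords_injective a)]

lemma norm_latticeChar_le (γ : periodLattice a) (k : UnitAddTorus (Fin d)) :
    ‖latticeChar a γ k‖ ≤ 1 :=
  ((UnitAddTorus.mFourier (latticeCoords a γ)).norm_coe_le_norm k).trans_eq
    UnitAddTorus.mFourier_norm

lemma exists_lipschitzWith_latticeChar_line (γ : periodLattice a) (k : UnitAddTorus (Fin d))
    (ω : Fin d → ℝ) :
    ∃ C, LipschitzWith C fun s => latticeChar a γ (k + UnitAddTorus.line ω s) := by
  set x : ℝ := 2 * Real.pi * ∑ i, latticeCoords a γ i * ω i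
  refine ⟨‖x‖₊, LipschitzWith.of_dist_le_mul fun s s' => ?_⟩
  have h1 : ∀ s, latticeChar a γ (k + UnitAddTorus.line ω s) =
      latticeChar a γ k * Complex.exp (Complex.I * (x * s : ℝ)) := fun s => by
    simp only [latticeChar, UnitAddTorus.mFourier_add_apply, UnitAddTorus.mFourier_line, x]
  have h2 : Complex.exp (Complex.I * (x * s : ℝ)) - Complex.exp (Complex.I * (x * s' : ℝ)) =
      Complex.exp (Complex.I * (x * s' : ℝ)) *
        (Complex.exp (Complex.I * (x * (s - s') : ℝ)) - 1) := by
    rw [mul_sub, ← Complex.exp_add, mul_one]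
    congr 2
    push_cast
    ring
  rw [h1, h1, dist_eq_norm, ← mul_sub, norm_mul, h2, norm_mul, Complex.norm_exp_I_mul_ofReal,
    one_mul]
  calc _ ≤ 1 * ‖x * (s - s')‖ :=
        mul_le_mul (norm_latticeChar_le _ _) Real.norm_exp_I_mul_ofReal_sub_one_le
          (norm_nonneg _) zero_le_one
    _ = _ := by rw [one_mul, norm_mul, Real.dist_eq]; rfl

end Lattice

/-! ### Floquet–Bloch decomposition of the Schrödinger operator. -/

namespace PeriodicGraph

variable {d : ℕ} {a : Module.Basis (Fin d) ℝ (EuclideanSpace ℝ (Fin d))} {V A : Type*}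
  [AddAction (periodLattice a) V] [AddAction (periodLattice a) A]

/-- The vertices of the quotient graph. -/
abbrev Cell (a : Module.Basis (Fin d) ℝ (EuclideanSpace ℝ (Fin d))) (V : Type*)
    [AddAction (periodLattice a) V] := AddAction.orbitRel.Quotient (periodLattice a) V

/-- The vertex of the quotient graph below a vertex. -/
def orb (_G : PeriodicGraph a V A) (v : V) : Cell a V := Quotient.mk _ v

/-- A chosen vertex above a vertex of the quotient graph. -/
def rep (_G : PeriodicGraph a V A) (i : Cell a V) : V := Quotient.out i

variable (G : PeriodicGraph a V A)

lemma orb_rep (i : Cell a V) : G.orb (G.rep i) = i := Quotient.out_eq i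

lemma orb_vadd (γ : periodLattice a) (v : V) : G.orb (γ +ᵥ v) = G.orb v :=
  Quotient.sound ⟨γ, rfl⟩

lemma vadd_right_cancel (G : PeriodicGraph a V A) {γ γ' : periodLattice a} {v : V}
    (h : γ +ᵥ v = γ' +ᵥ v) : γ = γ' := by
  have h1 := congrArg G.pos h
  rw [G.pos_vadd, G.pos_vadd] at h1
  exact Subtype.ext (add_left_cancel h1)

lemma exists_shift (v : V) : ∃ γ : periodLattice a, γ +ᵥ G.rep (G.orb v) = v :=
  Quotient.exact (s := AddAction.orbitRel (periodLattice a) V) (G.orb_rep (G.orb v)).symm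

/-- The lattice vector which moves the chosen vertex of an orbit to a given vertex of it. -/
def shift (v : V) : periodLattice a := (G.exists_shift v).choose

lemma shift_vadd_rep (v : V) : G.shift v +ᵥ G.rep (G.orb v) = v := (G.exists_shift v).choose_spec

lemma shift_vadd (γ : periodLattice a) (v : V) : G.shift (γ +ᵥ v) = γ + G.shift v := by
  apply G.vadd_right_cancel (v := G.rep (G.orb v))
  conv_lhs => rw [← G.orb_vadd γ v, G.shift_vadd_rep]
  rw [add_vadd, G.shift_vadd_rep]

lemma shift_rep (i : Cell a V) : G.shift (G.rep i) = 0 := by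
  apply G.vadd_right_cancel (v := G.rep i)
  have := G.shift_vadd_rep (G.rep i)
  rw [G.orb_rep] at this
  rw [this, zero_vadd]

lemma eq_rep_iff {v : V} {i : Cell a V} : v = G.rep i ↔ G.shift v = 0 ∧ G.orb v = i := by
  constructor
  · rintro rfl
    exact ⟨G.shift_rep i, G.orb_rep i⟩
  · rintro ⟨h1, rfl⟩
    conv_lhs => rw [← G.shift_vadd_rep v, h1, zero_vadd]

/-- Translation of the edges at a vertex. -/
def edgesAtVAdd (γ : periodLattice a) (v : V) : G.EdgesAt v ≃ G.EdgesAt (γ +ᵥ v) where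
  toFun e := ⟨γ +ᵥ e.1, by rw [G.src_vadd, e.2]⟩
  invFun e := ⟨-γ +ᵥ e.1, by rw [G.src_vadd, e.2, neg_vadd_vadd]⟩
  left_inv e := Subtype.ext (neg_vadd_vadd γ e.1)
  right_inv e := Subtype.ext (vadd_neg_vadd γ e.1)

variable (α : G.MagneticPotential) (Q : G.ElectricPotential)

/-- The operator commutes with lattice translations: they carry the edges at `v` to those at `γ +ᵥ
v` and preserve both potentials. -/
lemma schrodingerFun_vadd (f : V → ℂ) (γ : periodLattice a) (v : V) :
    G.schrodingerFun α Q f (γ +ᵥ v) = G.schrodingerFun α Q (fun w => f (γ +ᵥ w)) v := by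
  unfold schrodingerFun
  rw [← Equiv.sum_comp (G.edgesAtVAdd γ v)]
  simp [edgesAtVAdd, Q.periodic, α.periodic, G.tgt_vadd]

lemma schrodingerFun_const_mul (c : ℂ) (f : V → ℂ) (v : V) :
    G.schrodingerFun α Q (fun w => c * f w) v = c * G.schrodingerFun α Q f v := by
  simp only [schrodingerFun, mul_add, Finset.mul_sum]
  congr 1
  · exact Finset.sum_congr rfl fun e _ => by ring
  · ring

lemma schrodingerFun_sum {ι : Type*} (s : Finset ι) (f : ι → V → ℂ) (v : V) :
    G.schrodingerFun α Q (fun w => ∑ l ∈ s, f l w) v =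
      ∑ l ∈ s, G.schrodingerFun α Q (f l) v := by
  simp only [schrodingerFun, Finset.sum_add_distrib, Finset.mul_sum, ← Finset.sum_sub_distrib]
  rw [Finset.sum_comm]

/-- Each value is a finite sum, so no square summability is needed; this matters because
quasiperiodic functions need not lie in `ℓ²`. -/
lemma schrodingerFun_integral {X : Type*} [MeasurableSpace X] (μ : Measure X) {f : X → V → ℂ}
    (hf : ∀ v, Integrable (fun x => f x v) μ) (v : V) :
    G.schrodingerFun α Q (fun w => ∫ x, f x w ∂μ) v =
      ∫ x, G.schrodingerFun α Q (f x) v ∂μ := by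
  simp only [schrodingerFun]
  have h1 : ∀ e : G.EdgesAt v, Integrable
      (fun x => f x v - Complex.exp (Complex.I * α.toFun e) * f x (G.tgt e)) μ := fun e =>
    (hf v).sub ((hf _).const_mul _)
  rw [integral_add (integrable_finsetSum _ fun e _ => h1 e) ((hf v).const_mul _),
    integral_finsetSum _ fun e _ => h1 e, integral_const_mul]
  congr 1
  refine Finset.sum_congr rfl fun e _ => ?_
  rw [integral_sub (hf v) ((hf _).const_mul _), integral_const_mul]

lemma integrable_latticeChar_mul {P : UnitAddTorus (Fin d) → Matrix (Cell a V) (Cell a V) ℂ}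
    (hP : Continuous P) (γ : periodLattice a) (i j : Cell a V) :
    Integrable (fun k => latticeChar a γ k * P k i j) (UnitAddTorus.haar d) :=
  UnitAddTorus.integrable_of_continuous
    ((continuous_latticeChar γ).mul (hP.matrix_elem i j))

variable [DecidableEq (Cell a V)]

/-- The function on the vertices which is supported on the orbit `j` and quasiperiodic with
quasimomentum `k`. -/
def blochBasis (k : UnitAddTorus (Fin d)) (j : Cell a V) (v : V) : ℂ :=
  latticeChar a (G.shift v) k * (1 : Matrix (Cell a V) (Cell a V) ℂ) (G.orb v) j

/-- The fibre at the quasimomentum `k` of the Schrödinger operator. -/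
def blochMatrix (k : UnitAddTorus (Fin d)) : Matrix (Cell a V) (Cell a V) ℂ :=
  Matrix.of fun i j => G.schrodingerFun α Q (G.blochBasis k j) (G.rep i)

lemma continuous_blochBasis (j : Cell a V) (v : V) :
    Continuous fun k => G.blochBasis k j v :=
  (continuous_latticeChar _).mul continuous_const

lemma continuous_blochMatrix : Continuous (G.blochMatrix α Q) := by
  refine continuous_matrix fun i j => ?_
  simp only [blochMatrix, Matrix.of_apply, schrodingerFun]
  have := fun v => G.continuous_blochBasis j v
  fun_prop

lemma exists_lipschitzWith_blochMatrix_line (k : UnitAddTorus (Fin d)) (ω : Fin d → ℝ)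
    (i j : Cell a V) :
    ∃ C, LipschitzWith C fun s => G.blochMatrix α Q (k + UnitAddTorus.line ω s) i j := by
  have hmul : ∀ (c : ℂ) (f : ℝ → ℂ), (∃ C, LipschitzWith C f) →
      ∃ C, LipschitzWith C fun s => c * f s := by
    rintro c f ⟨C, hC⟩
    exact ⟨_, (lipschitzWith_smul c).comp hC⟩
  have hsum : ∀ {ι : Type _} (S : Finset ι) (f : ι → ℝ → ℂ), (∀ l, ∃ C, LipschitzWith C (f l)) →
      ∃ C, LipschitzWith C fun s => ∑ l ∈ S, f l s := by
    intro ι S f hf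
    choose C hC using hf
    classical
    induction S using Finset.induction_on with
    | empty => exact ⟨0, by simp⟩
    | insert l S hl ih =>
      obtain ⟨K, hK⟩ := ih
      refine ⟨C l + K, ?_⟩
      simpa only [Finset.sum_insert hl] using (hC l).add hK
  have hbasis : ∀ v, ∃ C, LipschitzWith C fun s =>
      G.blochBasis (k + UnitAddTorus.line ω s) j v := by
    intro v
    simp only [blochBasis, mul_comm (latticeChar a _ _)]
    exact hmul _ _ (exists_lipschitzWith_latticeChar_line _ k ω)
  obtain ⟨C, hC⟩ := hmul (Q.toFun (G.rep i)) _ (hbasis (G.rep i))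
  obtain ⟨C', hC'⟩ := hsum (Finset.univ : Finset (G.EdgesAt (G.rep i)))
    (fun e s => G.blochBasis (k + UnitAddTorus.line ω s) j (G.rep i) -
      Complex.exp (Complex.I * α.toFun e) * G.blochBasis (k + UnitAddTorus.line ω s) j (G.tgt e))
    fun e => by
      obtain ⟨K, hK⟩ := hbasis (G.rep i)
      obtain ⟨K', hK'⟩ := hmul (Complex.exp (Complex.I * α.toFun e)) _ (hbasis (G.tgt e))
      exact ⟨K + K', hK.sub hK'⟩
  exact ⟨C' + C, hC'.add hC⟩

lemma blochMatrix_apply (k : UnitAddTorus (Fin d)) (i j : Cell a V) :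
    G.blochMatrix α Q k i j =
      (Fintype.card (G.EdgesAt (G.rep i)) + Q.toFun (G.rep i)) *
          (1 : Matrix (Cell a V) (Cell a V) ℂ) i j -
        ∑ e ∈ Finset.univ.filter fun e : G.EdgesAt (G.rep i) => G.orb (G.tgt e) = j,
          Complex.exp (Complex.I * α.toFun e) * latticeChar a (G.shift (G.tgt e)) k := by
  simp only [blochMatrix, Matrix.of_apply, schrodingerFun, blochBasis, Finset.sum_sub_distrib,
    G.shift_rep, G.orb_rep, latticeChar_zero, Finset.sum_filter, Matrix.one_apply (i := G.orb _)]
  by_cases h : i = j <;> simp [Matrix.one_apply, h]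
  ring

/-- Reversing an edge from `rep i` to the orbit `j` and translating it back so that it starts at
`rep j` is an involution (`hinv`). It conjugates both the magnetic phase and the character. -/
lemma isHermitian_blochMatrix (k : UnitAddTorus (Fin d)) : (G.blochMatrix α Q k).IsHermitian := by
  have hsrc : ∀ {i j : Cell a V} (e : G.EdgesAt (G.rep i)), G.orb (G.tgt e) = j →
      G.src (-G.shift (G.tgt e) +ᵥ G.rev e) = G.rep j := by
    intro i j e he
    rw [G.src_vadd, G.src_rev, G.eq_rep_iff, G.shift_vadd, G.orb_vadd]
    exact ⟨neg_add_cancel _, he⟩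
  have htgt : ∀ {i : Cell a V} (e : G.EdgesAt (G.rep i)),
      G.tgt (-G.shift (G.tgt e) +ᵥ G.rev e) = -G.shift (G.tgt e) +ᵥ G.rep i := by
    intro i e
    rw [G.tgt_vadd, G.tgt_rev, e.2]
  have hinv : ∀ {i : Cell a V} (e : G.EdgesAt (G.rep i)),
      -G.shift (G.tgt (-G.shift (G.tgt e) +ᵥ G.rev e)) +ᵥ
        G.rev (-G.shift (G.tgt e) +ᵥ G.rev e) = e.1 := by
    intro i e
    rw [htgt, G.rev_vadd, G.rev_rev, G.shift_vadd, G.shift_rep, add_zero, neg_neg, vadd_neg_vadd]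
  refine Matrix.IsHermitian.ext fun i j => ?_
  rw [blochMatrix_apply, blochMatrix_apply, star_sub, star_sum]
  congr 1
  · by_cases h : i = j
    · subst h
      simp
    · simp [h, Ne.symm h]
  · refine Finset.sum_bij' (fun e he => ⟨_, hsrc e (Finset.mem_filter.mp he).2⟩)
      (fun e he => ⟨_, hsrc e (Finset.mem_filter.mp he).2⟩) (fun e he => ?_) (fun e he => ?_)
      (fun e he => Subtype.ext (hinv e)) (fun e he => Subtype.ext (hinv e)) fun e he => ?_
    · simp [htgt, G.orb_vadd, G.orb_rep]
    · simp [htgt, G.orb_vadd, G.orb_rep]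
    · simp only [htgt, G.shift_vadd, G.shift_rep, add_zero, α.periodic, α.map_rev, star_mul',
        latticeChar_neg]
      simp [← Complex.exp_conj]

variable [Fintype (Cell a V)]

lemma blochMatrix_mul_apply (k : UnitAddTorus (Fin d)) (P : Matrix (Cell a V) (Cell a V) ℂ)
    (i j : Cell a V) :
    (G.blochMatrix α Q k * P) i j =
      G.schrodingerFun α Q (fun v => latticeChar a (G.shift v) k * P (G.orb v) j) (G.rep i) := by
  have h1 : (fun v => latticeChar a (G.shift v) k * P (G.orb v) j) =
      fun v => ∑ l, P l j * G.blochBasis k l v := by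
    ext v
    simp [blochBasis, Matrix.one_apply, mul_comm]
  rw [h1, schrodingerFun_sum, Matrix.mul_apply]
  refine Finset.sum_congr rfl fun l _ => ?_
  rw [schrodingerFun_const_mul, mul_comm]
  rfl

/-- The inverse Floquet transform intertwines the operator with multiplication by the Bloch
matrices. -/
lemma schrodingerFun_integral_latticeChar
    {P : UnitAddTorus (Fin d) → Matrix (Cell a V) (Cell a V) ℂ} (hP : Continuous P)
    (j : Cell a V) (v : V) :
    G.schrodingerFun α Q
        (fun w => ∫ k, latticeChar a (G.shift w) k * P k (G.orb w) j ∂(UnitAddTorus.haar d)) v =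
      ∫ k, latticeChar a (G.shift v) k * (G.blochMatrix α Q k * P k) (G.orb v) j
        ∂(UnitAddTorus.haar d) := by
  rw [schrodingerFun_integral _ _ _ _ fun w => integrable_latticeChar_mul hP _ _ _]
  refine integral_congr_ae (Filter.Eventually.of_forall fun k => ?_)
  beta_reduce
  -- Moving `v` to the representative of its orbit takes the character of `shift v` out as a
  -- constant factor.
  conv_lhs => rw [← G.shift_vadd_rep v, schrodingerFun_vadd]
  simp only [G.shift_vadd, G.orb_vadd, latticeChar_add, mul_assoc]
  rw [schrodingerFun_const_mul, blochMatrix_mul_apply]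

/-- The kernel of a power of the Schrödinger operator, as a Fourier coefficient of the power of
the Bloch matrices. -/
theorem schrodinger_pow_single_apply [DecidableEq V] (n : ℕ) (j : Cell a V) (v : V) :
    ((G.schrodinger α Q).1 ^ n) (lp.single 2 (G.rep j) 1) v =
      ∫ k, latticeChar a (G.shift v) k * (G.blochMatrix α Q k ^ n) (G.orb v) j
        ∂(UnitAddTorus.haar d) := by
  induction n generalizing v with
  | zero =>
    simp only [pow_zero, integral_mul_const, integral_latticeChar, Matrix.one_apply]
    have h1 := G.eq_rep_iff (v := v) (i := j)
    by_cases hv : v = G.rep j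
    · obtain ⟨h2, h3⟩ := h1.mp hv
      subst hv
      simp [h2, h3]
    · have h2 : ¬ (G.shift v = 0 ∧ G.orb v = j) := fun h => hv (h1.mpr h)
      rw [one_apply_eq_self, lp.single_apply_ne _ _ _ hv]
      by_cases h3 : G.shift v = 0
      · simpa [h3] using h2
      · simp [h3]
  | succ n ih =>
    rw [pow_succ']
    change G.schrodingerFun α Q
      (((G.schrodinger α Q).1 ^ n) (lp.single 2 (G.rep j) 1)) v = _
    rw [funext ih, schrodingerFun_integral_latticeChar _ _ _
      (P := fun k => G.blochMatrix α Q k ^ n) ((G.continuous_blochMatrix α Q).pow n)]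
    simp only [pow_succ']

end PeriodicGraph

/-! ### Band functions and the density of states. -/

namespace PeriodicGraph

variable {d : ℕ} {a : Module.Basis (Fin d) ℝ (EuclideanSpace ℝ (Fin d))} {V A : Type*}
  [AddAction (periodLattice a) V] [AddAction (periodLattice a) A]

variable (G : PeriodicGraph a V A) (α : G.MagneticPotential) (Q : G.ElectricPotential)
  [DecidableEq (Cell a V)] [Fintype (Cell a V)]

/-- The band functions of the Schrödinger operator. -/
def bandFunction (l : Fin (Fintype.card (Cell a V))) (k : UnitAddTorus (Fin d)) : ℝ :=
  (G.isHermitian_blochMatrix α Q k).eigenvalues₀ l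

lemma trace_blochMatrix_pow (n : ℕ) (k : UnitAddTorus (Fin d)) :
    (G.blochMatrix α Q k ^ n).trace = ((∑ l, G.bandFunction α Q l k ^ n : ℝ) : ℂ) :=
  (G.isHermitian_blochMatrix α Q k).trace_pow_eq_sum_eigenvalues₀ n

lemma continuous_bandFunction (l : Fin (Fintype.card (Cell a V))) :
    Continuous (G.bandFunction α Q l) := by
  rw [continuous_iff_continuousAt]
  intro k
  rw [ContinuousAt, tendsto_iff_norm_sub_tendsto_zero]
  have h1 : ∀ k', ‖G.bandFunction α Q l k' - G.bandFunction α Q l k‖ ≤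
      (Fintype.card (Cell a V)) ^ 2 *
        ∑ i, ∑ j, ‖G.blochMatrix α Q k' i j - G.blochMatrix α Q k i j‖ := by
    intro k'
    refine Matrix.IsHermitian.abs_eigenvalues₀_sub_le _ _ (fun i j => ?_) l
    refine le_trans ?_ (Finset.single_le_sum (f := fun i => ∑ j,
      ‖G.blochMatrix α Q k' i j - G.blochMatrix α Q k i j‖)
      (fun i _ => Finset.sum_nonneg fun j _ => norm_nonneg _) (Finset.mem_univ i))
    exact Finset.single_le_sum
      (f := fun j => ‖G.blochMatrix α Q k' i j - G.blochMatrix α Q k i j‖)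
      (fun j _ => norm_nonneg _) (Finset.mem_univ j)
  refine squeeze_zero (fun _ => norm_nonneg _) h1 ?_
  have hc : ∀ i j, Continuous fun k => G.blochMatrix α Q k i j := fun i j =>
    (G.continuous_blochMatrix α Q).matrix_elem i j
  have h2 : Continuous fun k' => ((Fintype.card (Cell a V)) ^ 2 : ℝ) *
      ∑ i, ∑ j, ‖G.blochMatrix α Q k' i j - G.blochMatrix α Q k i j‖ := by fun_prop
  simpa using h2.tendsto k

lemma exists_lipschitzWith_bandFunction_line (l : Fin (Fintype.card (Cell a V)))
    (k : UnitAddTorus (Fin d)) (ω : Fin d → ℝ) :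
    ∃ C, LipschitzWith C fun s => G.bandFunction α Q l (k + UnitAddTorus.line ω s) := by
  choose C hC using G.exists_lipschitzWith_blochMatrix_line α Q k ω
  set K : NNReal := ∑ i, ∑ j, C i j
  have hK : ∀ i j, C i j ≤ K := fun i j =>
    (Finset.single_le_sum (f := fun j => C i j) (fun _ _ => bot_le) (Finset.mem_univ j)).trans
      (Finset.single_le_sum (f := fun i => ∑ j, C i j) (fun _ _ => bot_le) (Finset.mem_univ i))
  refine ⟨(Fintype.card (Cell a V)) ^ 2 * K, LipschitzWith.of_dist_le_mul fun s s' => ?_⟩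
  rw [Real.dist_eq]
  refine (Matrix.IsHermitian.abs_eigenvalues₀_sub_le _ _ (δ := K * dist s s')
    (fun i j => ?_) l).trans_eq ?_
  · rw [← dist_eq_norm]
    exact ((hC i j).dist_le_mul s s').trans
      (mul_le_mul_of_nonneg_right (NNReal.coe_le_coe.mpr (hK i j)) dist_nonneg)
  · push_cast
    ring

/-- For `γ = 0` this gives the moments of the density of states; for `γ ≠ 0` it gives the Fourier
coefficients that rule out flat bands without magnetic field. -/
lemma sum_schrodinger_pow_single [DecidableEq V] (n : ℕ) (γ : periodLattice a) :
    ∑ i, ((G.schrodinger α Q).1 ^ n) (lp.single 2 (G.rep i) 1) (γ +ᵥ G.rep i) =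
      ∫ k, latticeChar a γ k * (G.blochMatrix α Q k ^ n).trace ∂(UnitAddTorus.haar d) := by
  simp only [schrodinger_pow_single_apply, G.shift_vadd, G.orb_vadd, G.shift_rep, G.orb_rep,
    add_zero, Matrix.trace, Matrix.diag, Finset.mul_sum]
  exact (integral_finsetSum _ fun i _ => integrable_latticeChar_mul
    (P := fun k => G.blochMatrix α Q k ^ n) ((G.continuous_blochMatrix α Q).pow n) γ i i).symm

/-- The density of states: the sum of the spectral measures over a fundamental domain is the
distribution of the band functions. -/
theorem sum_spectralMeasure_eq [DecidableEq V] {μ : Cell a V → Measure ℝ}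
    (hμ : ∀ i, IsSpectralMeasure (G.schrodinger α Q) (lp.single 2 (G.rep i) 1) (μ i)) :
    ∑ i, μ i = ∑ l, (UnitAddTorus.haar d).map (G.bandFunction α Q l) := by
  have hfin := fun i => (hμ i).finite
  choose K hK hμK using fun i => (hμ i).compact_support
  have hband := G.continuous_bandFunction α Q
  set K' : Set ℝ := (⋃ i, K i) ∪ ⋃ l, Set.range (G.bandFunction α Q l)
  have hK' : IsCompact K' :=
    (isCompact_iUnion hK).union (isCompact_iUnion fun l => isCompact_range (hband l))
  refine Measure.ext_of_moments hK' ?_ ?_ fun n => ?_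
  · rw [Measure.finsetSum_apply]
    refine Finset.sum_eq_zero fun i _ => measure_mono_null ?_ (hμK i)
    exact Set.compl_subset_compl.mpr ((Set.subset_iUnion K i).trans Set.subset_union_left)
  · rw [Measure.finsetSum_apply]
    refine Finset.sum_eq_zero fun l _ => ?_
    rw [Measure.map_apply (hband l).measurable hK'.isClosed.measurableSet.compl]
    convert measure_empty (μ := UnitAddTorus.haar d)
    ext k
    simp only [Set.mem_preimage, Set.mem_compl_iff, Set.mem_empty_iff_false, iff_false, not_not]
    exact Or.inr (Set.mem_iUnion.mpr ⟨l, k, rfl⟩)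
  · have h1 : ∀ i, Integrable (fun x : ℝ => x ^ n) (μ i) := fun i =>
      Continuous.integrable_of_ae_mem_isCompact (hK i) (hμK i) (continuous_pow n)
    have hcomp : ∀ l, Continuous fun k => G.bandFunction α Q l k ^ n := fun l => (hband l).pow n
    have h2 : ∀ l, Integrable (fun x : ℝ => x ^ n)
        ((UnitAddTorus.haar d).map (G.bandFunction α Q l)) := fun l =>
      (integrable_map_measure (by fun_prop) (hband l).aemeasurable).mpr
        (UnitAddTorus.integrable_of_continuous (hcomp l))
    rw [integral_finsetSum_measure fun i _ => h1 i, integral_finsetSum_measure fun l _ => h2 l]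
    have h3 : ∀ l, ∫ x, x ^ n ∂((UnitAddTorus.haar d).map (G.bandFunction α Q l)) =
        ∫ k, G.bandFunction α Q l k ^ n ∂(UnitAddTorus.haar d) := fun l =>
      integral_map (hband l).aemeasurable (by fun_prop)
    simp only [h3]
    rw [← integral_finsetSum _ fun l _ => UnitAddTorus.integrable_of_continuous (hcomp l)]
    apply Complex.ofReal_injective
    rw [← integral_complex_ofReal, Complex.ofReal_sum]
    have h4 := G.sum_schrodinger_pow_single α Q n 0
    simp only [zero_vadd, latticeChar_zero, one_mul, trace_blochMatrix_pow] at h4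
    refine Eq.trans (Finset.sum_congr rfl fun i _ => ?_) h4
    rw [(hμ i).moment, lp.inner_single_left]
    simp

/-- If the absolutely continuous spectrum is empty then all bands are flat. -/
theorem trace_blochMatrix_pow_eq (h : ¬ (acSpectrum (G.schrodinger α Q)).Nonempty) (n : ℕ)
    (k k' : UnitAddTorus (Fin d)) :
    (G.blochMatrix α Q k ^ n).trace = (G.blochMatrix α Q k' ^ n).trace := by
  classical
  choose μ hμ using fun i : Cell a V =>
    exists_isSpectralMeasure (G.schrodinger α Q) (lp.single 2 (G.rep i) 1)
  have hsum : (∑ i, μ i) ⟂ₘ volume := by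
    refine Finset.sum_induction _ (fun ν => ν ⟂ₘ volume) (fun _ _ h1 h2 => h1.add_left h2)
      Measure.MutuallySingular.zero_left fun i _ => (hμ i).mutuallySingular_volume h
  rw [G.sum_spectralMeasure_eq α Q hμ] at hsum
  have hflat : ∀ l, G.bandFunction α Q l k = G.bandFunction α Q l k' := by
    intro l
    refine UnitAddTorus.eq_of_mutuallySingular_map (G.continuous_bandFunction α Q l)
      (G.exists_lipschitzWith_bandFunction_line α Q l) (hsum.mono ?_ le_rfl) k k'
    -- A positive measure dominated by a singular one is singular, so singularity of the sum passes
    -- to each band.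
    exact Finset.single_le_sum (f := fun l => (UnitAddTorus.haar d).map (G.bandFunction α Q l))
      (fun _ _ => bot_le) (Finset.mem_univ l)
  simp only [trace_blochMatrix_pow, hflat]

end PeriodicGraph

/-! ### Non-flat bands without magnetic field, and analyticity in the coupling constant. -/

namespace PeriodicGraph

variable {d : ℕ} {a : Module.Basis (Fin d) ℝ (EuclideanSpace ℝ (Fin d))} {V A : Type*}
  [AddAction (periodLattice a) V] [AddAction (periodLattice a) A]

/-- For a trivial lattice the infinite set `V` would inject into the finite set of orbits. -/
lemma exists_lattice_ne_zero (G : PeriodicGraph a V A) : ∃ γ : periodLattice a, γ ≠ 0 := by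
  by_contra! h
  have := G.finite_vertices
  have := G.infinite
  refine not_injective_infinite_finite G.orb fun v w hvw => ?_
  rw [← G.shift_vadd_rep v, ← G.shift_vadd_rep w, h (G.shift v), h (G.shift w), hvw]

variable (G : PeriodicGraph a V A) (α : G.MagneticPotential) (Q : G.ElectricPotential)

open scoped ComplexOrder in
/-- Without magnetic field, `C - H` has a kernel with nonnegative entries for large `C`, and the
entry at two given vertices is positive for a suitable power, since the graph is connected. -/
theorem exists_const_sub_schrodinger_pow_pos [DecidableEq V] (hα : ∀ e, α.toFun e = 0) :
    ∃ C : ℝ,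
      (∀ n u v, 0 ≤ (((C : ℂ) • (1 : ell2 V →L[ℂ] ell2 V) - (G.schrodinger α Q).1) ^ n :
        ell2 V →L[ℂ] ell2 V) (lp.single 2 u 1) v) ∧
      ∀ u v, ∃ n, 0 < (((C : ℂ) • (1 : ell2 V →L[ℂ] ell2 V) - (G.schrodinger α Q).1) ^ n :
        ell2 V →L[ℂ] ell2 V) (lp.single 2 u 1) v := by
  obtain ⟨q, hq0, hq⟩ := G.exists_bound Q
  -- This dominates degree plus `Q` at every vertex, so the diagonal coefficients of `C - H` are
  -- nonnegative; with all phases equal to 1 the edges contribute with a positive sign.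
  set C : ℝ := G.edgeCount + q
  set R : ell2 V →L[ℂ] ell2 V := (C : ℂ) • 1 - (G.schrodinger α Q).1
  have hR : ∀ (f : ell2 V) v, R f v =
      ((C - Fintype.card (G.EdgesAt v) - Q.toFun v : ℝ) : ℂ) * f v +
        ∑ e : G.EdgesAt v, f (G.tgt e) := by
    intro f v
    change (C : ℂ) * f v - G.schrodingerFun α Q f v = _
    simp only [schrodingerFun, hα, Finset.sum_sub_distrib]
    simp
    ring
  have hc : ∀ v, 0 ≤ ((C - Fintype.card (G.EdgesAt v) - Q.toFun v : ℝ) : ℂ) := by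
    intro v
    rw [Complex.zero_le_real]
    have h1 : (Fintype.card (G.EdgesAt v) : ℝ) ≤ G.edgeCount :=
      Nat.cast_le.mpr (G.card_edgesAt_le v)
    have h2 := (abs_le.mp (hq v)).2
    simp only [C]
    linarith
  have hnonneg : ∀ n u v, 0 ≤ (R ^ n) (lp.single 2 u 1) v := by
    intro n
    induction n with
    | zero =>
      intro u v
      change 0 ≤ (Pi.single u 1 : V → ℂ) v
      by_cases h : v = u
      · subst h
        simp
      · simp [h]
    | succ n ih =>
      intro u v
      rw [pow_succ']
      change 0 ≤ R ((R ^ n) (lp.single 2 u 1)) v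
      rw [hR]
      exact add_nonneg (mul_nonneg (hc v) (ih u v)) (Finset.sum_nonneg fun e _ => ih u _)
  refine ⟨C, hnonneg, fun u v => ?_⟩
  induction G.connected u v with
  | refl => exact ⟨0, by
      change 0 < (Pi.single u 1 : V → ℂ) u
      simp⟩
  | tail _ hvw ih =>
    obtain ⟨n, hn⟩ := ih
    obtain ⟨e, rfl, rfl⟩ := hvw
    refine ⟨n + 1, ?_⟩
    rw [pow_succ']
    change 0 < R ((R ^ n) (lp.single 2 u 1)) (G.tgt e)
    rw [hR]
    refine add_pos_of_nonneg_of_pos (mul_nonneg (hc _) (hnonneg n u _)) ?_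
    -- The sum at `G.tgt e` contains the reversed edge, which leads back to `G.src e`, where the
    -- `n`-th power is already positive.
    refine Finset.sum_pos' (fun e _ => hnonneg n u _)
      ⟨⟨G.rev e, G.src_rev e⟩, Finset.mem_univ _, ?_⟩
    rwa [G.tgt_rev]

variable [DecidableEq (Cell a V)]

lemma analyticAt_blochMatrix_smul (k : UnitAddTorus (Fin d)) (i j : Cell a V) (t : ℝ) :
    AnalyticAt ℝ (fun t : ℝ => G.blochMatrix (t • α) Q k i j) t := by
  have hexp : ∀ x : ℝ, AnalyticAt ℝ (fun t : ℝ => Complex.exp (Complex.I * (t * x : ℝ))) t := by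
    intro x
    have h1 : AnalyticAt ℝ (fun t : ℝ => Complex.I * ((t * x : ℝ) : ℂ)) t :=
      analyticAt_const.mul
        ((Complex.ofRealCLM.analyticAt _).comp (analyticAt_id.mul analyticAt_const))
    exact (analyticAt_cexp.restrictScalars (𝕜 := ℝ)).comp h1
  change AnalyticAt ℝ (fun t : ℝ => ∑ e : G.EdgesAt (G.rep i), (G.blochBasis k j (G.rep i) -
    Complex.exp (Complex.I * (t * α.toFun e : ℝ)) * G.blochBasis k j (G.tgt e)) +
      Q.toFun (G.rep i) * G.blochBasis k j (G.rep i)) t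
  exact (Finset.analyticAt_fun_sum _ fun e _ =>
    analyticAt_const.sub ((hexp _).mul analyticAt_const)).add analyticAt_const

variable [Fintype (Cell a V)]

open scoped ComplexOrder in
/-- Without magnetic field, not all bands are flat. -/
theorem exists_trace_blochMatrix_pow_ne (hα : ∀ e, α.toFun e = 0) :
    ∃ n k, (G.blochMatrix α Q k ^ n).trace ≠ (G.blochMatrix α Q 0 ^ n).trace := by
  classical
  by_contra! hflat
  obtain ⟨γ, hγ⟩ := G.exists_lattice_ne_zero
  obtain ⟨C, hC0, hC⟩ := G.exists_const_sub_schrodinger_pow_pos α Q hα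
  set T : ell2 V →L[ℂ] ell2 V := (G.schrodinger α Q).1
  -- A trace constant in `k` has zero Fourier coefficient at `γ ≠ 0`.
  have hpow : ∀ n, ∑ i, (T ^ n) (lp.single 2 (G.rep i) 1) (γ +ᵥ G.rep i) = 0 := by
    intro n
    rw [G.sum_schrodinger_pow_single α Q n γ]
    simp only [hflat]
    rw [integral_mul_const, integral_latticeChar, if_neg hγ, zero_mul]
  have hpoly : ∀ p : Polynomial ℂ,
      ∑ i, (Polynomial.aeval T p) (lp.single 2 (G.rep i) 1) (γ +ᵥ G.rep i) = 0 := by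
    intro p
    induction p using Polynomial.induction_on' with
    | add p q hp hq =>
      have h := congrArg₂ (· + ·) hp hq
      rw [add_zero, ← Finset.sum_add_distrib] at h
      rw [map_add]
      exact h
    | monomial n c =>
      rw [Polynomial.aeval_monomial, ← Algebra.smul_def, ← mul_zero c, ← hpow n, Finset.mul_sum]
      rfl
  have hinf := G.infinite
  obtain ⟨v⟩ : Nonempty V := inferInstance
  obtain ⟨n, hn⟩ := hC (G.rep (G.orb v)) (γ +ᵥ G.rep (G.orb v))
  -- For this polynomial every summand is nonnegative, and the one of the orbit of `v` is positive
  -- by the choice of `n`.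
  have h1 := hpoly ((Polynomial.C (C : ℂ) - Polynomial.X) ^ n)
  have h2 : Polynomial.aeval T ((Polynomial.C (C : ℂ) - Polynomial.X) ^ n) =
      ((C : ℂ) • 1 - T) ^ n := by
    rw [map_pow, map_sub, Polynomial.aeval_X, Polynomial.aeval_C, Algebra.algebraMap_eq_smul_one]
  rw [h2] at h1
  refine (Finset.sum_pos' (fun i _ => hC0 n (G.rep i) (γ +ᵥ G.rep i))
    ⟨G.orb v, Finset.mem_univ _, hn⟩).ne' h1

lemma analyticAt_trace_blochMatrix_smul_pow (k : UnitAddTorus (Fin d)) (n : ℕ) (t : ℝ) :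
    AnalyticAt ℝ (fun t : ℝ => (G.blochMatrix (t • α) Q k ^ n).trace) t := by
  have hpow : ∀ i j, AnalyticAt ℝ (fun t : ℝ => (G.blochMatrix (t • α) Q k ^ n) i j) t := by
    induction n with
    | zero => exact fun i j => analyticAt_const
    | succ n ih =>
      intro i j
      simp only [pow_succ, Matrix.mul_apply]
      exact Finset.analyticAt_fun_sum _ fun l _ =>
        (ih i l).mul (G.analyticAt_blochMatrix_smul α Q k l j t)
  exact Finset.analyticAt_fun_sum _ fun i _ => hpow i i

end PeriodicGraph

/-- A real-analytic function on the line which is not identically zero has finitely many zeros in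
a compact set. -/
lemma AnalyticOnNhd.finite_zeros_of_isCompact {f : ℝ → ℂ} (hf : AnalyticOnNhd ℝ f Set.univ)
    {t₀ : ℝ} (h0 : f t₀ ≠ 0) {K : Set ℝ} (hK : IsCompact K) : {t | t ∈ K ∧ f t = 0}.Finite := by
  by_contra hinf
  obtain ⟨x, -, hx⟩ := Set.Infinite.exists_accPt_of_subset_isCompact hinf hK fun t ht => ht.1
  have hfreq : ∃ᶠ t in nhdsWithin x {x}ᶜ, f t = 0 :=
    (accPt_iff_frequently_nhdsNE.mp hx).mono fun t ht => ht.2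
  exact h0 (hf.eqOn_zero_of_preconnected_of_frequently_eq_zero isPreconnected_univ
    (Set.mem_univ x) hfreq (Set.mem_univ t₀))

end

theorem theorem1p3 {d : ℕ} (a : Module.Basis (Fin d) ℝ (EuclideanSpace ℝ (Fin d)))
    {V A : Type*} [AddAction (periodLattice a) V] [AddAction (periodLattice a) A]
    (G : PeriodicGraph a V A) (α : G.MagneticPotential) (Q : G.ElectricPotential) :
    {t : ℝ | t ∈ Set.Icc (0 : ℝ) 1 ∧ ¬ (acSpectrum (G.schrodinger (t • α) Q)).Nonempty}.Finite := by
  classical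
  have := G.finite_vertices
  have : Fintype (PeriodicGraph.Cell a V) := Fintype.ofFinite _
  -- Writing the zero potential as `0 • α` places it in the family at `t₀ = 0`.
  obtain ⟨n, k, hk⟩ := G.exists_trace_blochMatrix_pow_ne ((0 : ℝ) • α) Q
    fun e => zero_mul (α.toFun e)
  have hf : AnalyticOnNhd ℝ (fun t : ℝ => (G.blochMatrix (t • α) Q k ^ n).trace -
      (G.blochMatrix (t • α) Q 0 ^ n).trace) Set.univ := fun t _ =>
    (G.analyticAt_trace_blochMatrix_smul_pow α Q k n t).sub
      (G.analyticAt_trace_blochMatrix_smul_pow α Q 0 n t)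
  refine (hf.finite_zeros_of_isCompact (sub_ne_zero.mpr hk)
    (isCompact_Icc (a := 0) (b := 1))).subset fun t ht => ⟨ht.1, sub_eq_zero.mpr ?_⟩
  exact G.trace_blochMatrix_pow_eq (t • α) Q ht.2 n k 0
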